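/- Let $\mathcal H$ be a complex Hilbert space with an orthonormal basis $|n\rangle$, $n\ge 0$, and let $a,a^\dagger$ be the annihilation and creation operators, $a|n\rangle=\sqrt n\,|n-1\rangle$, $a^\dagger|n\rangle=\sqrt{n+1}\,|n+1\rangle$, on their common domain $\{\psi:\sum_n n|\langle n|\psi\rangle|^2<\infty\}$. Let $\mathcal R$ be the ray space (unit vectors of $\mathcal H$ modulo phases, with the quotient topology), with the Fubini–Study Hermitian form $\langle X|P|Y\rangle$, $P=1-|\psi\rangle\langle\psi|$, at the ray of a unit vector $\psi$; its real part is the metric and its imaginary part the symplectic form. On $\mathbb C$ take the standard metric $g(X,Y)=\mathrm{Re}(\bar XY)$ and the standard symplectic form $\omega(X,Y)=\mathrm{Im}(\bar XY)$. (1) For every $\alpha\in\mathbb C$ there is exactly one strongly continuous one-parameter group of unitaries on $\mathcal H$ whose generator extends $\alpha a^\dagger-\bar\alpha a$. Its time-one element is denoted $D(\alpha)=\exp(\alpha a^\dagger-\bar\alpha a)$. (2) For every $v\in\mathbb R$ (with $\lambda=e^v$) there is a unit vector $|0;\lambda\rangle$ with $(\cosh v\,a+\sinh v\,a^\dagger)|0;\lambda\rangle=0$,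 and it is unique up to a phase. (3) Fix $v$ and $|0;\lambda\rangle$, and let $|\alpha;\lambda\rangle=D(\alpha)|0;\lambda\rangle$. The map $\alpha\mapsto|\alpha;\lambda\rangle\in\mathcal H$ is smooth. At every point of $\mathbb C$, the pull-back of the Fubini–Study form by $\alpha\mapsto[\,|\alpha;\lambda\rangle\,]$, evaluated on tangent vectors $(\dot\alpha,\alpha')$ with $\dot\alpha=\dot\alpha_1+i\dot\alpha_2$, $\alpha'=\alpha_1'+i\alpha_2'$, is $$(\alpha_1'\dot\alpha_1e^{2v}+\alpha_2'\dot\alpha_2e^{-2v})+i(\dot\alpha_1\alpha_2'-\dot\alpha_2\alpha_1').$$ (4) For every $v$ the map $\alpha\mapsto[\,|\alpha;\lambda\rangle\,]$ is a symplectic embedding of $\mathbb C$ into $\mathcal R$: it is a smooth immersion, a homeomorphism onto its image, and it pulls the symplectic form back to $\omega$. At each point of $\mathbb C$, the pulled-back metric equals $g$ if and only if $v=0$. The map is a Kähler embedding (a symplectic embedding that also pulls the metric back to $g$ and whose differential is complex linear) if and only if $v=0$. -/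

import Mathlib

open scoped ContDiff Topology ComplexConjugate

noncomputable section

namespace Squeezed

/-! ## The oscillator: ladder operators in the number basis -/

section Oscillator

variable {H : Type*} [NormedAddCommGroup H] [InnerProductSpace ℂ H]

/-- The natural common domain of `a` and `a†`: the vectors `ψ` with `∑ n |⟨n|ψ⟩|² < ∞`. -/
def ladderDomain (b : HilbertBasis ℕ ℂ H) : Submodule ℂ H where
  carrier := {ψ | Summable fun n : ℕ => (n : ℝ) * ‖b.repr ψ n‖ ^ 2}
  zero_mem' := by simp [summable_zero]
  add_mem' := by
    intro x y hx hy
    refine Summable.of_nonneg_of_le (fun n => by positivity) (fun n => ?_)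
      ((hx.mul_left 2).add (hy.mul_left 2))
    have h1 : ‖b.repr (x + y) n‖ ≤ ‖b.repr x n‖ + ‖b.repr y n‖ := by
      rw [map_add]; exact norm_add_le _ _
    have h2 : ‖b.repr (x + y) n‖ ^ 2 ≤ 2 * ‖b.repr x n‖ ^ 2 + 2 * ‖b.repr y n‖ ^ 2 := by
      nlinarith [norm_nonneg (b.repr (x + y) n), sq_nonneg (‖b.repr x n‖ - ‖b.repr y n‖)]
    have h3 := mul_le_mul_of_nonneg_left h2 (Nat.cast_nonneg (α := ℝ) n)
    linarith
  smul_mem' := by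
    intro c x hx
    refine (Summable.mul_left (‖c‖ ^ 2) hx).congr (fun n => ?_)
    simp only [map_smul, lp.coeFn_smul, Pi.smul_apply, norm_smul]
    ring

theorem summable_repr_sq (b : HilbertBasis ℕ ℂ H) (ψ : H) :
    Summable fun n : ℕ => ‖b.repr ψ n‖ ^ 2 := by
  have h := (memℓp_gen_iff (p := 2) (by norm_num)).1 (lp.memℓp (b.repr ψ))
  simpa using h

theorem memℓp_lower (b : HilbertBasis ℕ ℂ H) (ψ : ladderDomain b) :
    Memℓp (fun n : ℕ => ((√((n : ℝ) + 1) : ℝ) : ℂ) * b.repr (ψ : H) (n + 1)) 2 := by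
  refine (memℓp_gen_iff (p := 2) (by norm_num)).2 ?_
  have h := (summable_nat_add_iff 1).2 ψ.2
  refine h.congr (fun n => ?_)
  have h0 : (0 : ℝ) ≤ (n : ℝ) + 1 := by positivity
  simp [mul_pow, Real.sq_sqrt h0]

theorem memℓp_raise (b : HilbertBasis ℕ ℂ H) (ψ : ladderDomain b) :
    Memℓp (fun n : ℕ => ((√(n : ℝ) : ℝ) : ℂ) * b.repr (ψ : H) (n - 1)) 2 := by
  refine (memℓp_gen_iff (p := 2) (by norm_num)).2 ?_
  refine (summable_nat_add_iff 1).1 ?_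
  refine (Summable.add ψ.2 (summable_repr_sq b ψ)).congr (fun n => ?_)
  have h0 : (0 : ℝ) ≤ (n : ℝ) + 1 := by positivity
  simp [mul_pow, Real.sq_sqrt h0]
  ring

/-- The annihilation operator `a`, with `a |n⟩ = √n |n-1⟩`; in coordinates
`⟨n|aψ⟩ = √(n+1) ⟨n+1|ψ⟩`. -/
def annihilation (b : HilbertBasis ℕ ℂ H) : H →ₗ.[ℂ] H where
  domain := ladderDomain b
  toFun :=
    { toFun := fun ψ => b.repr.symm
        ⟨fun n : ℕ => ((√((n : ℝ) + 1) : ℝ) : ℂ) * b.repr (ψ : H) (n + 1), memℓp_lower b ψ⟩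
      map_add' := by
        intro x y
        rw [← map_add]
        congr 1
        ext n
        simp [mul_add]
        rfl
      map_smul' := by
        intro c x
        rw [RingHom.id_apply, ← map_smul]
        congr 1
        ext n
        simp [mul_left_comm] }

/-- The creation operator `a†`, with `a† |n⟩ = √(n+1) |n+1⟩`; in coordinates
`⟨n|a†ψ⟩ = √n ⟨n-1|ψ⟩`, which is `0` for `n = 0`. -/
def creation (b : HilbertBasis ℕ ℂ H) : H →ₗ.[ℂ] H where
  domain := ladderDomain b
  toFun :=
    { toFun := fun ψ => b.repr.symm
        ⟨fun n : ℕ => ((√(n : ℝ) : ℝ) : ℂ) * b.repr (ψ : H) (n - 1), memℓp_raise b ψ⟩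
      map_add' := by
        intro x y
        rw [← map_add]
        congr 1
        ext n
        simp [mul_add]
        rfl
      map_smul' := by
        intro c x
        rw [RingHom.id_apply, ← map_smul]
        congr 1
        ext n
        simp [mul_left_comm] }

/-- The deformed annihilation operator `cosh v · a + sinh v · a†`. -/
def squeezedAnnihilation (b : HilbertBasis ℕ ℂ H) (v : ℝ) : H →ₗ.[ℂ] H :=
  ((Real.cosh v : ℝ) : ℂ) • annihilation b + ((Real.sinh v : ℝ) : ℂ) • creation b

/-- A normalised vector annihilated by `cosh v · a + sinh v · a†`. -/
def IsSqueezedVacuum (b : HilbertBasis ℕ ℂ H) (v : ℝ) (ψ₀ : Metric.sphere (0 : H) 1) : Prop :=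
  ∃ h : (ψ₀ : H) ∈ (squeezedAnnihilation b v).domain, squeezedAnnihilation b v ⟨ψ₀, h⟩ = 0

/-- The operator `α a† - conj α · a`. -/
def displacementGenerator (b : HilbertBasis ℕ ℂ H) (α : ℂ) : H →ₗ.[ℂ] H :=
  α • creation b - conj α • annihilation b

/-- `U` is a strongly continuous one-parameter group of unitaries whose infinitesimal generator
extends the (skew-symmetric, unbounded) operator `T`. -/
structure IsUnitaryGroupGeneratedBy (T : H →ₗ.[ℂ] H) (U : ℝ → (H ≃ₗᵢ[ℂ] H)) : Prop where
  map_zero : U 0 = 1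
  map_add : ∀ s t : ℝ, U (s + t) = U s * U t
  continuous : ∀ φ : H, Continuous fun t : ℝ => U t φ
  hasDerivAt : ∀ φ : T.domain, HasDerivAt (fun t : ℝ => U t (φ : H)) (T φ) 0

open Classical in
/-- The exponential `exp T` of an unbounded operator `T` that generates a unitary group: the time
one element of that group.  (The value is `1` if `T` does not generate a unitary group.) -/
def unitaryExp (T : H →ₗ.[ℂ] H) : H ≃ₗᵢ[ℂ] H :=
  if h : ∃ U : ℝ → (H ≃ₗᵢ[ℂ] H), IsUnitaryGroupGeneratedBy T U then h.choose 1 else 1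

/-- The displacement operator `D(α) = exp (α a† - conj α · a)`. -/
def displacement (b : HilbertBasis ℕ ℂ H) (α : ℂ) : H ≃ₗᵢ[ℂ] H :=
  unitaryExp (displacementGenerator b α)

/-- The squeezed state `|α; λ⟩ = D(α) |0; λ⟩`, a normalised vector. -/
def squeezedState (b : HilbertBasis ℕ ℂ H) (ψ₀ : Metric.sphere (0 : H) 1) (α : ℂ) :
    Metric.sphere (0 : H) 1 :=
  ⟨displacement b α (ψ₀ : H), by
    rw [mem_sphere_zero_iff_norm, LinearIsometryEquiv.norm_map]
    exact mem_sphere_zero_iff_norm.1 ψ₀.2⟩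

end Oscillator

/-! ## The ray space and its Fubini-Study form -/

section RaySpace

variable (H : Type*) [NormedAddCommGroup H] [InnerProductSpace ℂ H]

/-- Normalised vectors are equivalent if they differ by a phase `exp (i γ)`. -/
def phaseSetoid : Setoid (Metric.sphere (0 : H) 1) where
  r ψ φ := ∃ γ : ℝ, (ψ : H) = Complex.exp (γ * Complex.I) • (φ : H)
  iseqv :=
    { refl := fun ψ => ⟨0, by simp⟩
      symm := by
        rintro ψ φ ⟨γ, h⟩
        refine ⟨-γ, ?_⟩
        rw [h, smul_smul, ← Complex.exp_add]
        simp
      trans := by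
        rintro ψ φ χ ⟨γ, h⟩ ⟨δ, k⟩
        refine ⟨γ + δ, ?_⟩
        rw [h, k, smul_smul, ← Complex.exp_add]
        push_cast
        ring_nf }

/-- The ray space: normalised vectors modulo phase, with the quotient topology. -/
abbrev RaySpace : Type _ := Quotient (phaseSetoid H)

variable {H}

/-- The ray `[ψ]` of a normalised vector. -/
def ray (ψ : Metric.sphere (0 : H) 1) : RaySpace H := Quotient.mk (phaseSetoid H) ψ

/-- The projector `P = 1 - |ψ⟩⟨ψ|` applied to `X`. -/
def proj (ψ X : H) : H := X - inner ℂ ψ X • ψ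

/-- The Fubini-Study Hermitian form `⟨X| P |Y⟩`, `P = 1 - |ψ⟩⟨ψ|`, at a normalised vector `ψ`.
Its real part is the metric, its imaginary part the symplectic form. -/
def fubiniStudy (ψ X Y : H) : ℂ := inner ℂ X (proj ψ Y)

/-- `ψ` is a lift of `f : ℂ → RaySpace H` to normalised vectors on a neighbourhood of `z`. -/
def IsLiftNear (f : ℂ → RaySpace H) (z : ℂ) (ψ : ℂ → H) : Prop :=
  ∀ᶠ w in 𝓝 z, ∃ h : ψ w ∈ Metric.sphere (0 : H) 1, ray ⟨ψ w, h⟩ = f w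

/-- `f` is smooth: near every point it has a smooth lift to normalised vectors. -/
def IsSmooth (f : ℂ → RaySpace H) : Prop :=
  ∀ z, ∃ ψ : ℂ → H, IsLiftNear f z ψ ∧ ContDiffAt ℝ ∞ ψ z

/-- The pull-back along `ψ : ℂ → H` of the Fubini-Study form, at `z`, on tangent vectors `X, Y`. -/
def pullback (ψ : ℂ → H) (z X Y : ℂ) : ℂ :=
  fubiniStudy (ψ z) (fderiv ℝ ψ z X) (fderiv ℝ ψ z Y)

/-- The pull-back by `f` of the Fubini-Study form on the ray space is the form `h`
on `ℂ` at the point `z`, as computed in every lift of `f` that is differentiable there. -/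
def HasPullbackAt (f : ℂ → RaySpace H) (z : ℂ) (h : ℂ → ℂ → ℂ) : Prop :=
  ∀ ψ : ℂ → H, IsLiftNear f z ψ → DifferentiableAt ℝ ψ z → ∀ X Y, pullback ψ z X Y = h X Y

/-- The pull-back by `f` of the symplectic form of the ray space is, at `z`, the standard
symplectic form `Im (conj X * Y)` of the plane. -/
def PullsBackSymplecticAt (f : ℂ → RaySpace H) (z : ℂ) : Prop :=
  ∀ ψ : ℂ → H, IsLiftNear f z ψ → DifferentiableAt ℝ ψ z →
    ∀ X Y, (pullback ψ z X Y).im = (conj X * Y).im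

/-- The pull-back by `f` of the metric of the ray space is, at `z`, the standard metric
`Re (conj X * Y)` of the plane. -/
def PullsBackMetricAt (f : ℂ → RaySpace H) (z : ℂ) : Prop :=
  ∀ ψ : ℂ → H, IsLiftNear f z ψ → DifferentiableAt ℝ ψ z →
    ∀ X Y, (pullback ψ z X Y).re = (conj X * Y).re

/-- The push-forward of tangent vectors by `f` at `z` commutes with multiplication by `i`. -/
def PreservesComplexStructureAt (f : ℂ → RaySpace H) (z : ℂ) : Prop :=
  ∀ ψ : ℂ → H, IsLiftNear f z ψ → DifferentiableAt ℝ ψ z →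
    ∀ X, proj (ψ z) (fderiv ℝ ψ z (Complex.I * X)) = Complex.I • proj (ψ z) (fderiv ℝ ψ z X)

/-- A smooth embedding of the plane into the ray space: a smooth immersion that is a homeomorphism
onto its image. -/
structure IsSmoothEmbedding (f : ℂ → RaySpace H) : Prop where
  smooth : IsSmooth f
  immersion : ∀ z, ∀ ψ : ℂ → H, IsLiftNear f z ψ → DifferentiableAt ℝ ψ z →
    ∀ X, proj (ψ z) (fderiv ℝ ψ z X) = 0 → X = 0
  isEmbedding : Topology.IsEmbedding f

/-- A smooth embedding that pulls the symplectic form back to the standard one. -/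
structure IsSymplecticEmbedding (f : ℂ → RaySpace H) : Prop extends IsSmoothEmbedding f where
  symplectic : ∀ z, PullsBackSymplecticAt f z

/-- A smooth embedding that respects the symplectic, metrical and complex structures. -/
structure IsKahlerEmbedding (f : ℂ → RaySpace H) : Prop extends IsSymplecticEmbedding f where
  metric : ∀ z, PullsBackMetricAt f z
  complex : ∀ z, PreservesComplexStructureAt f z

end RaySpace

end Squeezed

end

noncomputable section

namespace Squeezed

variable {H : Type*} [NormedAddCommGroup H] [InnerProductSpace ℂ H] (b : HilbertBasis ℕ ℂ H)

/-! ## Coordinates of the ladder operators -/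

/-! The coherent vectors `coherent b z = ∑ zⁿ/√n! |n⟩` have Gram kernel `exp (conj z * w)` and are
total, since pairing with them gives a power series whose coefficients determine a vector. On them
`a` is multiplication by `z` and `a†` is `d/dz`. The map `coherent z ↦ exp (-|α|²/2 - conj α z)
coherent (z + α)` preserves the kernel, so it extends to a unitary `weyl b α`. The Weyl relation
`weyl_weyl`, checked on coherent vectors, makes `t ↦ weyl b (t * α)` a group. Its derivative on the
whole ladder domain comes from an integral formula tested against coherent vectors, whose orbits are
explicit (`weyl_eq_add_integral`). Uniqueness holds because the pairing of another group's orbit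
with a Weyl orbit has zero derivative (`IsUnitaryGroupGeneratedBy.eq_weyl`). Hence `D(α)` is `weyl b
α`.

In coordinates the vacuum equation is a two-step recursion with factors bounded by `|tanh v| < 1`.
The solution is therefore unique up to a scalar and rapidly decreasing. Since `a` and `a†` preserve
rapid decrease, `α ↦ weyl b α ψ₀` is smooth.

The geometry rests on one fact (`exists_excited`): `a†ψ₀ = cosh v η` and `aψ₀ = -sinh v η` for a
unit vector `η` orthogonal to `ψ₀`. So `(X a† - conj X a) ψ₀ = c(X) η` with `c(X) = cosh v X + sinh
v conj X = X₁ eᵛ + i X₂ e⁻ᵛ`. After projection, a tangent vector of any lift is `c(X)` times a fixed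
unit vector, and the pulled-back form is `conj c(X) * c(Y)`. As `c` preserves area, the symplectic
part is standard for every `v`; the metric is standard only for `v = 0`. The embedding property
follows from the Gaussian overlap `exp (-|c(w - z)|²/2)`, a continuous function on the ray space
that controls `|w - z|`. -/

/-- The annihilation operator as a linear map on its domain. -/
def lower : ladderDomain b →ₗ[ℂ] H := (annihilation b).toFun

/-- The creation operator as a linear map on its domain. -/
def raise : ladderDomain b →ₗ[ℂ] H := (creation b).toFun

/-- The operator `α a† - conj α · a` as a linear map on its domain. -/
def ladderCombination (α : ℂ) : ladderDomain b →ₗ[ℂ] H := α • raise b - conj α • lower b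

/-- Completeness is not assumed of `H`; it is transported from `ℓ²` along `b.repr`. -/
theorem completeSpace_of_hilbertBasis {H : Type*} [NormedAddCommGroup H] [InnerProductSpace ℂ H]
    (b : HilbertBasis ℕ ℂ H) : CompleteSpace H :=
  (completeSpace_congr (e := b.repr.toEquiv) b.repr.isometry.isUniformEmbedding).2 inferInstance

theorem hasSum_repr_inner (x y : H) :
    HasSum (fun n => conj (b.repr x n) * b.repr y n) (inner ℂ x y) := by
  have h := lp.hasSum_inner (𝕜 := ℂ) (b.repr x) (b.repr y)
  rw [b.repr.inner_map_map] at h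
  simpa [RCLike.inner_apply, mul_comm] using h

theorem hasSum_repr_sq (x : H) : HasSum (fun n => ‖b.repr x n‖ ^ 2) (‖x‖ ^ 2) := by
  have h := hasSum_repr_inner b x x
  rw [inner_self_eq_norm_sq_to_K] at h
  have h2 : HasSum (fun n => ((‖b.repr x n‖ ^ 2 : ℝ) : ℂ)) ((‖x‖ ^ 2 : ℝ) : ℂ) := by
    convert h using 1
    · ext n
      rw [mul_comm, Complex.mul_conj, Complex.normSq_eq_norm_sq]
    · simp
  exact_mod_cast h2

theorem ext_repr {x y : H} (h : ∀ n, b.repr x n = b.repr y n) : x = y :=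
  b.repr.injective (lp.ext (funext h))

theorem mem_ladderDomain {φ : H} :
    φ ∈ ladderDomain b ↔ Summable fun n : ℕ => (n : ℝ) * ‖b.repr φ n‖ ^ 2 := Iff.rfl

theorem repr_lower (φ : ladderDomain b) (n : ℕ) :
    b.repr (lower b φ) n = ((√((n : ℝ) + 1) : ℝ) : ℂ) * b.repr (φ : H) (n + 1) := by
  simp [lower, annihilation]

theorem repr_raise_zero (φ : ladderDomain b) : b.repr (raise b φ) 0 = 0 := by
  simp [raise, creation]

theorem repr_raise_succ (φ : ladderDomain b) (n : ℕ) :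
    b.repr (raise b φ) (n + 1) = ((√((n : ℝ) + 1) : ℝ) : ℂ) * b.repr (φ : H) n := by
  simp [raise, creation]

theorem inner_raise_left (x y : ladderDomain b) :
    inner ℂ (raise b x) (y : H) = inner ℂ (x : H) (lower b y) := by
  have h1 := hasSum_repr_inner b (raise b x) (y : H)
  have h2 := hasSum_repr_inner b (x : H) (lower b y)
  rw [← hasSum_nat_add_iff' 1] at h1
  simp only [Finset.range_one, Finset.sum_singleton, repr_raise_zero, map_zero, zero_mul,
    sub_zero] at h1
  refine h1.unique (h2.congr_fun ?_)
  intro n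
  rw [repr_raise_succ, repr_lower]
  simp
  ring

theorem inner_lower_left (x y : ladderDomain b) :
    inner ℂ (lower b x) (y : H) = inner ℂ (x : H) (raise b y) := by
  rw [← inner_conj_symm, ← inner_raise_left, inner_conj_symm]

/-- The commutation relation `[a, a†] = 1` as a quadratic form, which avoids the smaller domains of
`a a†` and `a† a`. -/
theorem norm_raise_sq (x : ladderDomain b) :
    ‖raise b x‖ ^ 2 = ‖lower b x‖ ^ 2 + ‖(x : H)‖ ^ 2 := by
  have h1 := hasSum_repr_sq b (raise b x)
  have h2 := hasSum_repr_sq b (lower b x)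
  have h3 := hasSum_repr_sq b (x : H)
  rw [← hasSum_nat_add_iff' 1] at h1
  simp only [Finset.range_one, Finset.sum_singleton, repr_raise_zero, norm_zero, ne_eq,
    OfNat.ofNat_ne_zero, not_false_eq_true, zero_pow, sub_zero] at h1
  have h0 : ∀ n : ℕ, (0 : ℝ) ≤ (n : ℝ) + 1 := fun n => by positivity
  have h2' : HasSum (fun n : ℕ => (n : ℝ) * ‖b.repr (x : H) n‖ ^ 2) (‖lower b x‖ ^ 2) := by
    rw [← hasSum_nat_add_iff' 1]
    simpa [repr_lower, mul_pow, Real.sq_sqrt, h0] using h2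
  refine h1.unique ((h2'.add h3).congr_fun fun n => ?_)
  rw [repr_raise_succ]
  simp [mul_pow, Real.sq_sqrt, h0]
  ring

/-- Square-summability of the coordinates of `ξ` is exactly the domain condition on `φ`, so
membership comes for free with the value. -/
theorem exists_lower_eq {φ ξ : H}
    (h : ∀ n : ℕ, ((√((n : ℝ) + 1) : ℝ) : ℂ) * b.repr φ (n + 1) = b.repr ξ n) :
    ∃ hφ : φ ∈ ladderDomain b, lower b ⟨φ, hφ⟩ = ξ := by
  have hφ : φ ∈ ladderDomain b := by
    rw [mem_ladderDomain, ← summable_nat_add_iff 1]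
    refine (summable_repr_sq b ξ).congr fun n => ?_
    have h0 : (0 : ℝ) ≤ (n : ℝ) + 1 := by positivity
    rw [← h n]
    simp [mul_pow, Real.sq_sqrt h0]
  exact ⟨hφ, ext_repr b fun n => by rw [repr_lower, h]⟩

theorem mem_domain_displacementGenerator {α : ℂ} {φ : H} :
    φ ∈ (displacementGenerator b α).domain ↔ φ ∈ ladderDomain b := by
  change φ ∈ ladderDomain b ⊓ ladderDomain b ↔ _
  simp

theorem mem_domain_squeezedAnnihilation {v : ℝ} {φ : H} :
    φ ∈ (squeezedAnnihilation b v).domain ↔ φ ∈ ladderDomain b := by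
  change φ ∈ ladderDomain b ⊓ ladderDomain b ↔ _
  simp

theorem ladderCombination_apply (α : ℂ) (φ : ladderDomain b) :
    ladderCombination b α φ = α • raise b φ - conj α • lower b φ := rfl

theorem inner_ladderCombination_left (α : ℂ) (x y : ladderDomain b) :
    inner ℂ (ladderCombination b α x) (y : H) = -inner ℂ (x : H) (ladderCombination b α y) := by
  simp only [ladderCombination_apply, inner_sub_left, inner_sub_right, inner_smul_left,
    inner_smul_right,
    inner_raise_left, inner_lower_left, Complex.conj_conj]
  ring

/-! ## Coherent vectors -/

/-- Writing the term as `x * y` with `x = (2R)ⁿ/√n!` and `y = 2⁻ⁿ`, the bound `|x * y| ≤ x² + y²`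
leaves an exponential and a geometric series. -/
theorem summable_pow_div_sqrt_factorial (R : ℝ) :
    Summable fun n : ℕ => R ^ n / √(n.factorial : ℝ) := by
  have h1 := Real.summable_pow_div_factorial (4 * R ^ 2)
  have h2 : Summable fun n : ℕ => ((1 : ℝ) / 4) ^ n :=
    summable_geometric_of_lt_one (by norm_num) (by norm_num)
  refine Summable.of_norm_bounded (h1.add h2) fun n => ?_
  have h3 : R ^ n / √(n.factorial : ℝ) = ((2 * R) ^ n / √(n.factorial : ℝ)) * (1 / 2) ^ n := by
    rw [mul_pow, div_pow, one_pow]; field_simp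
  have h4 : (4 * R ^ 2) ^ n / (n.factorial : ℝ) = ((2 * R) ^ n / √(n.factorial : ℝ)) ^ 2 := by
    rw [div_pow, Real.sq_sqrt (by positivity), ← pow_mul, mul_comm n 2, pow_mul]; ring_nf
  have h5 : ((1 : ℝ) / 4) ^ n = ((1 / 2) ^ n) ^ 2 := by
    rw [← pow_mul, mul_comm n 2, pow_mul]; norm_num
  rw [h3, h4, h5, Real.norm_eq_abs, abs_le]
  constructor <;>
  nlinarith [sq_nonneg ((2 * R) ^ n / √(n.factorial : ℝ) + (1 / 2) ^ n),
    sq_nonneg ((2 * R) ^ n / √(n.factorial : ℝ) - (1 / 2) ^ n),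
    sq_nonneg ((2 * R) ^ n / √(n.factorial : ℝ)), sq_nonneg (((1 : ℝ) / 2) ^ n)]

/-- The unnormalised coherent vector `∑ zⁿ / √n! |n⟩`. -/
def coherent (z : ℂ) : H := ∑' n : ℕ, (z ^ n / ((√(n.factorial : ℝ) : ℝ) : ℂ)) • b n

/-- The derivative of `z ↦ coherent b z`. -/
def coherentDeriv (z : ℂ) : H :=
  ∑' n : ℕ, ((n : ℂ) * z ^ (n - 1) / ((√(n.factorial : ℝ) : ℝ) : ℂ)) • b n

theorem norm_hilbertBasis (n : ℕ) : ‖b n‖ = 1 := b.orthonormal.1 n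

theorem norm_pow_div_le {z : ℂ} {R : ℝ} (hz : ‖z‖ ≤ R) (n : ℕ) :
    ‖(z ^ n / ((√(n.factorial : ℝ) : ℝ) : ℂ)) • b n‖ ≤ R ^ n / √(n.factorial : ℝ) := by
  rw [norm_smul, norm_hilbertBasis, norm_div, norm_pow, Complex.norm_real,
    Real.norm_of_nonneg (Real.sqrt_nonneg _), mul_one]
  gcongr

/-- `n ≤ 2ⁿ` absorbs the factor from differentiation, and `1 ≤ R` lets the exponent `n - 1` be
raised to `n`, so the derived series has a majorant of the same kind. -/
theorem norm_natCast_mul_pow_div_le {z : ℂ} {R : ℝ} (hR : 1 ≤ R) (hz : ‖z‖ ≤ R) (n : ℕ) :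
    ‖((n : ℂ) * z ^ (n - 1) / ((√(n.factorial : ℝ) : ℝ) : ℂ)) • b n‖ ≤
      (2 * R) ^ n / √(n.factorial : ℝ) := by
  rw [norm_smul, norm_hilbertBasis, norm_div, norm_mul, norm_pow, Complex.norm_real,
    Real.norm_of_nonneg (Real.sqrt_nonneg _), mul_one, mul_pow, Complex.norm_natCast]
  have h1 : (n : ℝ) ≤ 2 ^ n := by exact_mod_cast n.lt_two_pow_self.le
  have h2 : ‖z‖ ^ (n - 1) ≤ R ^ n :=
    (pow_le_pow_left₀ (norm_nonneg _) hz _).trans (pow_le_pow_right₀ hR (Nat.sub_le _ _))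
  gcongr

theorem hasSum_coherent (z : ℂ) :
    HasSum (fun n : ℕ => (z ^ n / ((√(n.factorial : ℝ) : ℝ) : ℂ)) • b n) (coherent b z) := by
  have := completeSpace_of_hilbertBasis b
  exact (Summable.of_norm_bounded (summable_pow_div_sqrt_factorial ‖z‖)
    (norm_pow_div_le b le_rfl)).hasSum

theorem hasSum_coherentDeriv (z : ℂ) :
    HasSum (fun n : ℕ => ((n : ℂ) * z ^ (n - 1) / ((√(n.factorial : ℝ) : ℝ) : ℂ)) • b n)
      (coherentDeriv b z) := by
  have := completeSpace_of_hilbertBasis b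
  exact (Summable.of_norm_bounded (summable_pow_div_sqrt_factorial (2 * (‖z‖ + 1)))
    (norm_natCast_mul_pow_div_le b (by linarith [norm_nonneg z]) (by linarith))).hasSum

theorem hasDerivAt_coherent (z : ℂ) : HasDerivAt (coherent b) (coherentDeriv b z) z := by
  have := completeSpace_of_hilbertBasis b
  refine hasDerivAt_tsum_of_isPreconnected (t := Metric.ball 0 (‖z‖ + 1)) (y₀ := 0)
    (summable_pow_div_sqrt_factorial (2 * (‖z‖ + 1))) Metric.isOpen_ball
    (convex_ball _ _).isPreconnected (fun n w _ => ?_)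
    (fun n w hw => norm_natCast_mul_pow_div_le b (z := w) (by linarith [norm_nonneg z])
      (mem_ball_zero_iff.1 hw).le n)
    (by simp; positivity) (hasSum_coherent b 0).summable (by simp)
  exact ((hasDerivAt_pow n w).div_const _).smul_const _

theorem repr_eq_of_hasSum {c : ℕ → ℂ} {x : H} (h : HasSum (fun n => c n • b n) x) (n : ℕ) :
    b.repr x n = c n := by
  rw [b.repr_apply_apply]
  have h1 := h.mapL (innerSL ℂ (b n))
  refine h1.unique ?_
  convert hasSum_single n ?_ using 1
  · simp [norm_hilbertBasis]
  · intro m hm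
    simp [b.orthonormal.2 hm.symm]

theorem repr_coherent (z : ℂ) (n : ℕ) :
    b.repr (coherent b z) n = z ^ n / ((√(n.factorial : ℝ) : ℝ) : ℂ) :=
  repr_eq_of_hasSum b (hasSum_coherent b z) n

theorem repr_coherentDeriv (z : ℂ) (n : ℕ) :
    b.repr (coherentDeriv b z) n = (n : ℂ) * z ^ (n - 1) / ((√(n.factorial : ℝ) : ℝ) : ℂ) :=
  repr_eq_of_hasSum b (hasSum_coherentDeriv b z) n

theorem sqrt_factorial_succ (n : ℕ) :
    √((n + 1).factorial : ℝ) = √((n : ℝ) + 1) * √(n.factorial : ℝ) := by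
  rw [Nat.factorial_succ, Nat.cast_mul, Real.sqrt_mul (by positivity)]
  push_cast; rfl

theorem sqrt_factorial_ne_zero (n : ℕ) : ((√(n.factorial : ℝ) : ℝ) : ℂ) ≠ 0 := by
  simp [Nat.factorial_ne_zero]

theorem sqrt_succ_ne_zero (n : ℕ) : ((√((n : ℝ) + 1) : ℝ) : ℂ) ≠ 0 := by
  have : (0 : ℝ) < √((n : ℝ) + 1) := by positivity
  exact_mod_cast this.ne'

theorem sqrt_succ_mul_self (n : ℕ) :
    ((√((n : ℝ) + 1) : ℝ) : ℂ) * ((√((n : ℝ) + 1) : ℝ) : ℂ) = (n : ℂ) + 1 := by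
  rw [← Complex.ofReal_mul, Real.mul_self_sqrt (by positivity)]
  push_cast; rfl

theorem exists_lower_coherent (z : ℂ) :
    ∃ h : coherent b z ∈ ladderDomain b, lower b ⟨coherent b z, h⟩ = z • coherent b z := by
  refine exists_lower_eq b fun n => ?_
  rw [map_smul, lp.coeFn_smul, Pi.smul_apply, repr_coherent, repr_coherent, sqrt_factorial_succ,
    smul_eq_mul, Complex.ofReal_mul]
  have := sqrt_factorial_ne_zero n
  have := sqrt_succ_ne_zero n
  field_simp
  ring

theorem coherent_mem (z : ℂ) : coherent b z ∈ ladderDomain b :=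
  (exists_lower_coherent b z).1

theorem lower_coherent (z : ℂ) :
    lower b ⟨coherent b z, coherent_mem b z⟩ = z • coherent b z :=
  (exists_lower_coherent b z).2

theorem raise_coherent (z : ℂ) :
    raise b ⟨coherent b z, coherent_mem b z⟩ = coherentDeriv b z := by
  refine ext_repr b fun n => ?_
  rw [repr_coherentDeriv]
  cases n with
  | zero => rw [repr_raise_zero]; simp
  | succ n =>
    rw [repr_raise_succ, repr_coherent, sqrt_factorial_succ, Complex.ofReal_mul]
    have := sqrt_factorial_ne_zero n
    have := sqrt_succ_ne_zero n
    have h := sqrt_succ_mul_self n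
    push_cast
    rw [← h]
    field_simp

theorem inner_coherent_coherent (z w : ℂ) :
    inner ℂ (coherent b z) (coherent b w) = Complex.exp (conj z * w) := by
  refine (hasSum_repr_inner b _ _).unique ?_
  rw [Complex.exp_eq_exp_ℂ]
  refine (NormedSpace.expSeries_div_hasSum_exp (conj z * w)).congr_fun fun n => ?_
  rw [repr_coherent, repr_coherent, map_div₀, map_pow, Complex.conj_ofReal, mul_pow]
  have : ((n.factorial : ℝ) : ℂ) =
      ((√(n.factorial : ℝ) : ℝ) : ℂ) * ((√(n.factorial : ℝ) : ℝ) : ℂ) := by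
    rw [← Complex.ofReal_mul, Real.mul_self_sqrt (by positivity)]
  rw [Complex.ofReal_natCast] at this
  rw [this]
  have := sqrt_factorial_ne_zero n
  field_simp

/-- Uniqueness of power series coefficients, which turns identities against all coherent vectors
into identities of coordinates. -/
theorem eq_zero_of_hasSum_pow {c : ℕ → ℂ} (h : ∀ z : ℂ, HasSum (fun n => z ^ n * c n) 0) (n : ℕ) :
    c n = 0 := by
  have h1 : HasFPowerSeriesAt (0 : ℂ → ℂ) (FormalMultilinearSeries.ofScalars ℂ c) 0 := by
    rw [hasFPowerSeriesAt_iff]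
    refine Filter.Eventually.of_forall fun z => ?_
    simpa [FormalMultilinearSeries.coeff_ofScalars] using h z
  have h2 := congrArg (fun p => FormalMultilinearSeries.coeff p n) h1.eq_zero
  rwa [FormalMultilinearSeries.coeff_ofScalars] at h2

/-- The argument `conj z` undoes the conjugate-linearity of the first slot, so that the pairing is a
power series in `z`. -/
theorem hasSum_inner_coherent (z : ℂ) (x : H) :
    HasSum (fun n : ℕ => z ^ n * (b.repr x n / ((√(n.factorial : ℝ) : ℝ) : ℂ)))
      (inner ℂ (coherent b (conj z)) x) := by
  refine (hasSum_repr_inner b _ _).congr_fun fun n => ?_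
  rw [repr_coherent, map_div₀, map_pow, Complex.conj_conj, Complex.conj_ofReal]
  ring

theorem hasSum_inner_coherentDeriv (z : ℂ) (x : H) :
    HasSum (fun n : ℕ => z ^ n * (((√((n : ℝ) + 1) : ℝ) : ℂ) * b.repr x (n + 1) /
      ((√(n.factorial : ℝ) : ℝ) : ℂ))) (inner ℂ (coherentDeriv b (conj z)) x) := by
  have h := hasSum_repr_inner b (coherentDeriv b (conj z)) x
  rw [← hasSum_nat_add_iff' 1] at h
  simp only [Finset.range_one, Finset.sum_singleton, repr_coherentDeriv] at h
  simp only [Nat.cast_zero, zero_mul, zero_div, map_zero, sub_zero] at h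
  refine h.congr_fun fun n => ?_
  rw [sqrt_factorial_succ, map_div₀, map_mul, map_pow, Complex.conj_conj, Complex.conj_ofReal,
    Complex.conj_natCast, Nat.add_sub_cancel, Complex.ofReal_mul]
  have := sqrt_factorial_ne_zero n
  have := sqrt_succ_ne_zero n
  have h := sqrt_succ_mul_self n
  push_cast
  rw [← h]
  field_simp

theorem eq_of_inner_coherent {x y : H}
    (h : ∀ z, inner ℂ (coherent b z) x = inner ℂ (coherent b z) y) : x = y := by
  refine ext_repr b fun n => ?_
  have h1 := eq_zero_of_hasSum_pow
    (c := fun n => b.repr x n / ((√(n.factorial : ℝ) : ℝ) : ℂ) -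
      b.repr y n / ((√(n.factorial : ℝ) : ℝ) : ℂ)) (fun z => ?_) n
  · rw [← sub_div, div_eq_zero_iff, or_iff_left (sqrt_factorial_ne_zero n)] at h1
    exact sub_eq_zero.1 h1
  · have h2 := (hasSum_inner_coherent b z x).sub (hasSum_inner_coherent b z y)
    rw [h, sub_self] at h2
    simpa only [mul_sub] using h2

/-- Since `coherentDeriv` is `a†` of `coherent`, the hypothesis is the weak form of `aχ = ξ`.
Coherent vectors suffice as test vectors, and the weak equation already puts `χ` in the domain. -/
theorem exists_lower_of_inner_coherentDeriv {χ ξ : H}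
    (h : ∀ z, inner ℂ (coherentDeriv b z) χ = inner ℂ (coherent b z) ξ) :
    ∃ hχ : χ ∈ ladderDomain b, lower b ⟨χ, hχ⟩ = ξ := by
  refine exists_lower_eq b fun n => ?_
  have h1 := eq_zero_of_hasSum_pow
    (c := fun n => ((√((n : ℝ) + 1) : ℝ) : ℂ) * b.repr χ (n + 1) /
      ((√(n.factorial : ℝ) : ℝ) : ℂ) - b.repr ξ n / ((√(n.factorial : ℝ) : ℝ) : ℂ))
    (fun z => ?_) n
  · rw [← sub_div, div_eq_zero_iff, or_iff_left (sqrt_factorial_ne_zero n)] at h1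
    exact sub_eq_zero.1 h1
  · have h2 := (hasSum_inner_coherentDeriv b z χ).sub (hasSum_inner_coherent b z ξ)
    rw [h, sub_self] at h2
    simpa only [mul_sub] using h2

theorem dense_span_coherent : Dense (Submodule.span ℂ (Set.range (coherent b)) : Set H) := by
  have := completeSpace_of_hilbertBasis b
  rw [Submodule.dense_iff_topologicalClosure_eq_top, Submodule.topologicalClosure_eq_top_iff,
    Submodule.eq_bot_iff]
  intro x hx
  refine eq_of_inner_coherent b fun z => ?_
  rw [inner_zero_right]
  exact (Submodule.mem_orthogonal _ _).1 hx _ (Submodule.subset_span ⟨z, rfl⟩)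

/-! ## Displacement operators -/

theorem norm_linearCombination_eq_of_inner {ι : Type*} {e f : ι → H}
    (h : ∀ i j, inner ℂ (e i) (e j) = inner ℂ (f i) (f j)) (x : ι →₀ ℂ) :
    ‖Finsupp.linearCombination ℂ f x‖ = ‖Finsupp.linearCombination ℂ e x‖ := by
  have h1 : inner ℂ (Finsupp.linearCombination ℂ f x) (Finsupp.linearCombination ℂ f x) =
      inner ℂ (Finsupp.linearCombination ℂ e x) (Finsupp.linearCombination ℂ e x) := by
    simp only [Finsupp.linearCombination_apply, Finsupp.sum, sum_inner, inner_sum, inner_smul_left,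
      inner_smul_right, h]
  rw [inner_self_eq_norm_sq_to_K, inner_self_eq_norm_sq_to_K] at h1
  have h2 : ‖Finsupp.linearCombination ℂ f x‖ ^ 2 = ‖Finsupp.linearCombination ℂ e x‖ ^ 2 := by
    exact_mod_cast h1
  exact (pow_left_inj₀ (norm_nonneg _) (norm_nonneg _) two_ne_zero).1 h2

/-- The image of the coherent vector at `z` under the displacement by `α`. -/
def displacedCoherent (α z : ℂ) : H :=
  Complex.exp (-(conj α * α) / 2 - conj α * z) • coherent b (z + α)

/-- Expanding `conj (z + α) * (w + α)` yields `conj z * w` plus three terms, and these are cancelled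
by the scalar prefactors. -/
theorem inner_displacedCoherent (α z w : ℂ) :
    inner ℂ (displacedCoherent b α z) (displacedCoherent b α w) =
      inner ℂ (coherent b z) (coherent b w) := by
  simp only [displacedCoherent, inner_smul_left, inner_smul_right, inner_coherent_coherent,
    ← Complex.exp_conj, ← Complex.exp_add, map_add, map_sub, map_neg, map_mul, map_div₀,
    Complex.conj_conj]
  congr 1
  rw [show (conj (2 : ℂ)) = 2 from Complex.conj_ofNat 2]
  ring

theorem denseRange_linearCombination_coherent :
    DenseRange (Finsupp.linearCombination ℂ (coherent b)) := by
  have h := dense_span_coherent b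
  rwa [← Finsupp.range_linearCombination] at h

theorem denseRange_linearCombination_displacedCoherent (α : ℂ) :
    DenseRange (Finsupp.linearCombination ℂ (displacedCoherent b α)) := by
  have h : Dense (Submodule.span ℂ (Set.range (displacedCoherent b α)) : Set H) := by
    refine (dense_span_coherent b).mono ?_
    rw [SetLike.coe_subset_coe, Submodule.span_le]
    rintro _ ⟨z, rfl⟩
    -- The displaced vector at `z - α` is a nonzero multiple of the coherent vector at `z`.
    have h1 : displacedCoherent b α (z - α) ∈
        Submodule.span ℂ (Set.range (displacedCoherent b α)) := Submodule.subset_span ⟨_, rfl⟩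
    rw [displacedCoherent, sub_add_cancel] at h1
    exact (Submodule.smul_mem_iff _ (Complex.exp_ne_zero _)).1 h1
  rwa [← Finsupp.range_linearCombination] at h

/-- The unitary operator that displaces coherent vectors by `α`. -/
def weyl (α : ℂ) : H ≃ₗᵢ[ℂ] H :=
  haveI := completeSpace_of_hilbertBasis b
  (LinearEquiv.refl ℂ (ℂ →₀ ℂ)).extendOfIsometry
    (Finsupp.linearCombination ℂ (coherent b))
    (Finsupp.linearCombination ℂ (displacedCoherent b α))
    (denseRange_linearCombination_coherent b)
    (denseRange_linearCombination_displacedCoherent b α)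
    (norm_linearCombination_eq_of_inner fun z w => (inner_displacedCoherent b α z w).symm)

theorem weyl_coherent (α z : ℂ) :
    weyl b α (coherent b z) =
      Complex.exp (-(conj α * α) / 2 - conj α * z) • coherent b (z + α) := by
  have := completeSpace_of_hilbertBasis b
  have h := LinearEquiv.extendOfIsometry_eq (LinearEquiv.refl ℂ (ℂ →₀ ℂ))
    (Finsupp.linearCombination ℂ (coherent b))
    (Finsupp.linearCombination ℂ (displacedCoherent b α))
    (denseRange_linearCombination_coherent b)
    (denseRange_linearCombination_displacedCoherent b α)
    (norm_linearCombination_eq_of_inner fun z w => (inner_displacedCoherent b α z w).symm)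
    (Finsupp.single z 1)
  simpa [weyl, displacedCoherent] using h

theorem eq_of_eq_on_coherent {A B : H →L[ℂ] H} (h : ∀ z, A (coherent b z) = B (coherent b z)) :
    A = B :=
  ContinuousLinearMap.ext_on (dense_span_coherent b) (by rintro _ ⟨z, rfl⟩; exact h z)

/-- The exponent is `i Im (α * conj β)`: displacements compose only up to a phase, which disappears
when `α` and `β` are real multiples of one number. -/
theorem weyl_weyl (α β : ℂ) (φ : H) :
    weyl b α (weyl b β φ) =
      Complex.exp ((α * conj β - conj α * β) / 2) • weyl b (α + β) φ := by
  have h := eq_of_eq_on_coherent b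
    (A := ((weyl b α).toContinuousLinearEquiv : H →L[ℂ] H) ∘L
      ((weyl b β).toContinuousLinearEquiv : H →L[ℂ] H))
    (B := Complex.exp ((α * conj β - conj α * β) / 2) •
      ((weyl b (α + β)).toContinuousLinearEquiv : H →L[ℂ] H)) fun z => by
      simp only [ContinuousLinearMap.comp_apply, smul_apply,
        ContinuousLinearEquiv.coe_coe, LinearIsometryEquiv.coe_toContinuousLinearEquiv,
        weyl_coherent, map_smul, smul_smul, ← Complex.exp_add]
      rw [show z + β + α = z + (α + β) by ring]
      congr 2
      simp only [map_add]
      ring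
  exact DFunLike.congr_fun h φ

theorem weyl_zero (φ : H) : weyl b 0 φ = φ := by
  have h := eq_of_eq_on_coherent b
    (A := ((weyl b 0).toContinuousLinearEquiv : H →L[ℂ] H)) (B := ContinuousLinearMap.id ℂ H)
    fun z => by simp [weyl_coherent]
  exact DFunLike.congr_fun h φ

theorem weyl_weyl_neg (α : ℂ) (φ : H) : weyl b α (weyl b (-α) φ) = φ := by
  rw [weyl_weyl]
  simp [weyl_zero, mul_comm]

theorem inner_weyl_left (α : ℂ) (x y : H) :
    inner ℂ (weyl b α x) y = inner ℂ x (weyl b (-α) y) := by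
  conv_lhs => rw [← weyl_weyl_neg b α y]
  exact (weyl b α).inner_map_map _ _

theorem weyl_real_mul_add (α : ℂ) (s t : ℝ) (φ : H) :
    weyl b ((s + t : ℝ) * α) φ = weyl b (s * α) (weyl b (t * α) φ) := by
  rw [weyl_weyl, ← add_mul, ← Complex.ofReal_add]
  have h : ((s : ℂ) * α * conj ((t : ℂ) * α) - conj ((s : ℂ) * α) * ((t : ℂ) * α)) / 2 = 0 := by
    simp only [map_mul, Complex.conj_ofReal]
    ring
  rw [h, Complex.exp_zero, one_smul]

theorem continuous_coherent : Continuous (coherent b) :=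
  continuous_iff_continuousAt.2 fun z => (hasDerivAt_coherent b z).continuousAt

/-- On the span of the coherent vectors the orbit is explicit. The operators are isometries, so
approximating `φ` approximates its orbit uniformly in `α`, and continuity passes to the closure. -/
theorem continuous_weyl (φ : H) : Continuous fun α => weyl b α φ := by
  refine Dense.induction (P := fun φ => Continuous fun α => weyl b α φ)
    (dense_span_coherent b) (fun φ hφ => ?_) ?_ φ
  · induction hφ using Submodule.span_induction with
    | mem x hx =>
      obtain ⟨z, rfl⟩ := hx
      simp only [weyl_coherent]
      have := continuous_coherent b
      have := Complex.continuous_conj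
      fun_prop
    | zero => simpa using continuous_const
    | add x y _ _ hx hy => simpa using! hx.add hy
    | smul c x _ hx => simpa using! hx.const_smul c
  · rw [← closure_subset_iff_isClosed]
    intro φ hφ
    refine continuous_of_uniform_approx_of_continuous fun u hu => ?_
    obtain ⟨ε, hε, hu⟩ := Metric.mem_uniformity_dist.1 hu
    obtain ⟨φ', h1, h2⟩ := Metric.mem_closure_iff.1 hφ ε hε
    refine ⟨_, h1, fun α => hu ?_⟩
    rwa [(weyl b α).dist_map]

/-! ## The generator of the displacement group -/

theorem weyl_coherent_mem (α z : ℂ) : weyl b α (coherent b z) ∈ ladderDomain b := by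
  rw [weyl_coherent]
  exact Submodule.smul_mem _ _ (coherent_mem b _)

theorem ladderCombination_weyl_coherent (β α z : ℂ) :
    ladderCombination b β ⟨weyl b α (coherent b z), weyl_coherent_mem b α z⟩ =
      Complex.exp (-(conj α * α) / 2 - conj α * z) •
        (β • coherentDeriv b (z + α) - (conj β * (z + α)) • coherent b (z + α)) := by
  have h : (⟨weyl b α (coherent b z), weyl_coherent_mem b α z⟩ : ladderDomain b) =
      Complex.exp (-(conj α * α) / 2 - conj α * z) •
        ⟨coherent b (z + α), coherent_mem b (z + α)⟩ := Subtype.ext (weyl_coherent b α z)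
  rw [h, map_smul, ladderCombination_apply, raise_coherent, lower_coherent, smul_smul (conj β)]

theorem hasDerivAt_weyl_coherent (α z : ℂ) (t : ℝ) :
    HasDerivAt (fun t : ℝ => weyl b (t * α) (coherent b z))
      (ladderCombination b α
        ⟨weyl b (t * α) (coherent b z), weyl_coherent_mem b (t * α) z⟩) t := by
  -- For real `t`, `conj (t * α) = t * conj α`; replacing `t` by a complex `s` in this form makes
  -- the orbit holomorphic, and its derivative is then restricted to the real line.
  have h1 : HasDerivAt
      (fun s : ℂ => Complex.exp (-(s ^ 2 * (conj α * α)) / 2 - s * (conj α * z)))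
      (Complex.exp (-((t : ℂ) ^ 2 * (conj α * α)) / 2 - t * (conj α * z)) *
        (-(t * (conj α * α)) - conj α * z)) (t : ℂ) := by
    have h := (((((hasDerivAt_id (t : ℂ)).pow 2).mul_const (conj α * α)).neg.div_const 2).sub
      ((hasDerivAt_id (t : ℂ)).mul_const (conj α * z))).cexp
    refine HasDerivAt.congr_deriv h ?_
    simp
    ring
  have h2 : HasDerivAt (fun s : ℂ => coherent b (z + s * α))
      (α • coherentDeriv b (z + t * α)) (t : ℂ) := by
    have h := (hasDerivAt_coherent b (z + t * α)).scomp (t : ℂ)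
      (((hasDerivAt_id (t : ℂ)).mul_const α).const_add z)
    simpa using! h
  have h3 := HasDerivAt.scomp t (h1.smul h2) Complex.ofRealCLM.hasDerivAt
  rw [ladderCombination_weyl_coherent]
  convert! h3 using 1
  · ext s
    rw [weyl_coherent, map_mul, Complex.conj_ofReal]
    congr 2
    ring
  · rw [map_mul, Complex.conj_ofReal]
    have h4 : -((t : ℂ) * conj α * (t * α)) / 2 - t * conj α * z =
        -((t : ℂ) ^ 2 * (conj α * α)) / 2 - t * (conj α * z) := by ring
    rw [h4, Complex.ofRealCLM_apply, Complex.ofReal_one]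
    module

/-- Paired with a coherent vector, both sides have the same derivative in `t`. On the left,
unitarity moves the operator to the coherent vector, whose orbit is explicitly differentiable, and
skew-symmetry moves the generator back onto `φ`. Differentiability of the orbit of `φ` is thus a
consequence, not an input. -/
theorem weyl_eq_add_integral (α : ℂ) (φ : ladderDomain b) (t : ℝ) :
    weyl b (t * α) (φ : H) =
      φ + ∫ s in (0 : ℝ)..t, weyl b (s * α) (ladderCombination b α φ) := by
  have := completeSpace_of_hilbertBasis b
  have hc : Continuous fun s : ℝ => weyl b (s * α) (ladderCombination b α φ) :=
    (continuous_weyl b _).comp (by fun_prop)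
  refine eq_of_inner_coherent b fun z => ?_
  have h1 : ∀ t : ℝ, HasDerivAt (fun t : ℝ => inner ℂ (coherent b z) (weyl b (t * α) (φ : H)))
      (inner ℂ (coherent b z) (weyl b (t * α) (ladderCombination b α φ))) t := by
    intro t
    have h := (hasDerivAt_weyl_coherent b (-α) z t).inner ℂ (hasDerivAt_const t (φ : H))
    have e : ∀ (s : ℝ) (x y : H), inner ℂ (weyl b (s * -α) x) y =
        inner ℂ x (weyl b (s * α) y) := by
      intro s x y
      rw [inner_weyl_left]
      simp
    simp only [e] at h
    refine h.congr_deriv ?_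
    have h2 := inner_ladderCombination_left b (-α)
      ⟨weyl b (t * -α) (coherent b z), weyl_coherent_mem b (t * -α) z⟩ φ
    rw [map_zero, inner_zero_right, zero_add, h2, ← e]
    simp only [ladderCombination_apply, map_neg, neg_smul, ← inner_neg_right]
    congr 1
    abel
  have h2 : ∀ t : ℝ, HasDerivAt (fun t : ℝ => inner ℂ (coherent b z)
      ((φ : H) + ∫ s in (0 : ℝ)..t, weyl b (s * α) (ladderCombination b α φ)))
      (inner ℂ (coherent b z) (weyl b (t * α) (ladderCombination b α φ))) t := by
    intro t
    have h := (hasDerivAt_const t (coherent b z)).inner ℂ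
      ((hc.integral_hasStrictDerivAt 0 t).hasDerivAt.const_add (φ : H))
    exact h.congr_deriv (by simp)
  have h3 := is_const_of_deriv_eq_zero (fun t => ((h1 t).sub (h2 t)).differentiableAt)
    (fun t => by rw [((h1 t).sub (h2 t)).deriv, sub_self]) t 0
  simpa [weyl_zero, sub_eq_zero] using h3

theorem hasDerivAt_weyl (α : ℂ) (φ : ladderDomain b) (t : ℝ) :
    HasDerivAt (fun t : ℝ => weyl b (t * α) (φ : H))
      (weyl b (t * α) (ladderCombination b α φ)) t := by
  have := completeSpace_of_hilbertBasis b
  have hc : Continuous fun s : ℝ => weyl b (s * α) (ladderCombination b α φ) :=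
    (continuous_weyl b _).comp (by fun_prop)
  simp only [weyl_eq_add_integral b α φ]
  exact (hc.integral_hasStrictDerivAt 0 t).hasDerivAt.const_add (φ : H)

theorem isUnitaryGroupGeneratedBy_weyl (α : ℂ) :
    IsUnitaryGroupGeneratedBy (displacementGenerator b α) fun t : ℝ => weyl b (t * α) where
  map_zero := by
    ext φ
    simp [weyl_zero]
  map_add s t := by
    ext φ
    exact weyl_real_mul_add b α s t φ
  continuous φ := (continuous_weyl b φ).comp (by fun_prop)
  hasDerivAt φ := by
    have h := hasDerivAt_weyl b α ⟨φ, (mem_domain_displacementGenerator b).1 φ.2⟩ 0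
    simpa [weyl_zero] using! h

/-! ### Uniqueness of the displacement group -/

section Uniqueness

variable {b} {α : ℂ} {U : ℝ → (H ≃ₗᵢ[ℂ] H)}

theorem IsUnitaryGroupGeneratedBy.apply_neg_apply {T : H →ₗ.[ℂ] H}
    (hU : IsUnitaryGroupGeneratedBy T U) (t : ℝ) (x : H) : U t (U (-t) x) = x := by
  have h := hU.map_add t (-t)
  rw [add_neg_cancel, hU.map_zero] at h
  exact (DFunLike.congr_fun h x).symm

theorem IsUnitaryGroupGeneratedBy.inner_left {T : H →ₗ.[ℂ] H}
    (hU : IsUnitaryGroupGeneratedBy T U) (t : ℝ) (x y : H) :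
    inner ℂ (U t x) y = inner ℂ x (U (-t) y) := by
  conv_lhs => rw [← hU.apply_neg_apply t y]
  exact (U t).inner_map_map _ _

theorem IsUnitaryGroupGeneratedBy.hasDerivAt_apply {T : H →ₗ.[ℂ] H}
    (hU : IsUnitaryGroupGeneratedBy T U) (φ : T.domain) (t : ℝ) :
    HasDerivAt (fun s : ℝ => U s (φ : H)) (U t (T φ)) t := by
  have h := hU.hasDerivAt φ
  rw [← sub_self t] at h
  have h1 := h.comp_sub_const t t
  have h2 := (((U t).toContinuousLinearEquiv : H →L[ℂ] H).restrictScalars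
    ℝ).hasFDerivAt.comp_hasDerivAt t h1
  convert! h2 using 1
  ext s
  have h3 := hU.map_add t (s - t)
  rw [add_sub_cancel] at h3
  rw [h3]
  rfl

/-- Both sides are, up to sign, the derivative of `⟨U t w, x⟩ = ⟨w, U (-t) x⟩`, computed from either
slot. -/
theorem IsUnitaryGroupGeneratedBy.inner_apply_generator {T : H →ₗ.[ℂ] H}
    (hU : IsUnitaryGroupGeneratedBy T U) (w x : T.domain) (t : ℝ) :
    inner ℂ (U t (w : H)) (T x) = -inner ℂ (U t (T w)) (x : H) := by
  have h1 := (hU.hasDerivAt_apply w t).inner ℂ (hasDerivAt_const t (x : H))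
  have h2 : HasDerivAt (fun s : ℝ => U (-s) (x : H)) (-U (-t) (T x)) t := by
    simpa using! (hU.hasDerivAt_apply x (-t)).scomp t (hasDerivAt_neg t)
  have h3 := (hasDerivAt_const t (w : H)).inner ℂ h2
  have h4 := h1.unique (h3.congr_of_eventuallyEq
    (Filter.Eventually.of_forall fun s => hU.inner_left s w x))
  rw [hU.inner_left t (w : H) (T x)]
  simp only [inner_zero_right, zero_add, inner_zero_left, add_zero, inner_neg_right] at h4
  rw [h4, neg_neg]

/-- Weyl orbits of coherent vectors stay in the ladder domain, so `⟨U t (coherent w), weyl (t * α)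
(coherent z)⟩` is differentiable, and skewness of the generator makes it constant. By totality `U
(-t)` inverts the Weyl operator on coherent vectors. -/
theorem IsUnitaryGroupGeneratedBy.eq_weyl
    (hU : IsUnitaryGroupGeneratedBy (displacementGenerator b α) U) (t : ℝ) :
    U t = weyl b (t * α) := by
  have key : ∀ z, U t (coherent b z) = weyl b (t * α) (coherent b z) := by
    intro z
    have h0 : U (-t) (weyl b (t * α) (coherent b z)) = coherent b z := by
      refine eq_of_inner_coherent b fun w => ?_
      rw [← hU.inner_left]
      have h1 : ∀ t : ℝ, HasDerivAt
          (fun t : ℝ => inner ℂ (U t (coherent b w)) (weyl b (t * α) (coherent b z))) 0 t := by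
        intro t
        have hw := (mem_domain_displacementGenerator b (α := α)).2 (coherent_mem b w)
        have hz := (mem_domain_displacementGenerator b (α := α)).2
          (weyl_coherent_mem b (t * α) z)
        have h2 := (hU.hasDerivAt_apply ⟨_, hw⟩ t).inner ℂ (hasDerivAt_weyl_coherent b α z t)
        have h3 : inner ℂ (U t (coherent b w)) (ladderCombination b α
            ⟨weyl b (t * α) (coherent b z), weyl_coherent_mem b (t * α) z⟩) = _ :=
          hU.inner_apply_generator ⟨_, hw⟩ ⟨_, hz⟩ t
        refine h2.congr_deriv ?_
        rw [h3, neg_add_cancel]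
      have h2 := is_const_of_deriv_eq_zero (fun t => (h1 t).differentiableAt)
        (fun t => (h1 t).deriv) t 0
      simpa [hU.map_zero, weyl_zero] using h2
    rw [← h0, hU.apply_neg_apply, h0]
  have h := eq_of_eq_on_coherent b (A := ((U t).toContinuousLinearEquiv : H →L[ℂ] H))
    (B := ((weyl b (t * α)).toContinuousLinearEquiv : H →L[ℂ] H)) key
  ext x
  exact DFunLike.congr_fun h x

end Uniqueness

theorem existsUnique_isUnitaryGroupGeneratedBy (α : ℂ) :
    ∃! U : ℝ → (H ≃ₗᵢ[ℂ] H), IsUnitaryGroupGeneratedBy (displacementGenerator b α) U :=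
  ⟨_, isUnitaryGroupGeneratedBy_weyl b α, fun _ hU => funext fun t => hU.eq_weyl t⟩

theorem displacement_eq_weyl (α : ℂ) : displacement b α = weyl b α := by
  have h : ∃ U : ℝ → (H ≃ₗᵢ[ℂ] H), IsUnitaryGroupGeneratedBy (displacementGenerator b α) U :=
    ⟨_, isUnitaryGroupGeneratedBy_weyl b α⟩
  rw [displacement, unitaryExp, dif_pos h, h.choose_spec.eq_weyl 1]
  simp

/-! ## Conjugation of the annihilation operator -/

/-- The derivative in `z` of the formula `weyl_coherent`: the prefactor contributes `-conj α`, the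
displaced coherent vector contributes `a†`. -/
theorem weyl_coherentDeriv (α z : ℂ) :
    weyl b α (coherentDeriv b z) =
      raise b ⟨weyl b α (coherent b z), weyl_coherent_mem b α z⟩ -
        conj α • weyl b α (coherent b z) := by
  have h1 := ((weyl b α).toContinuousLinearEquiv : H →L[ℂ] H).hasFDerivAt.comp_hasDerivAt z
    (hasDerivAt_coherent b z)
  have h2 : HasDerivAt (fun z => Complex.exp (-(conj α * α) / 2 - conj α * z))
      (Complex.exp (-(conj α * α) / 2 - conj α * z) * -conj α) z := by
    simpa using (((hasDerivAt_id z).const_mul (conj α)).const_sub (-(conj α * α) / 2)).cexp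
  have h3 := h2.smul ((hasDerivAt_coherent b (z + α)).comp_add_const z α)
  have h4 := h1.unique (h3.congr_of_eventuallyEq
    (Filter.Eventually.of_forall fun w => weyl_coherent b α w))
  have h5 : (⟨weyl b α (coherent b z), weyl_coherent_mem b α z⟩ : ladderDomain b) =
      Complex.exp (-(conj α * α) / 2 - conj α * z) •
        ⟨coherent b (z + α), coherent_mem b (z + α)⟩ := Subtype.ext (weyl_coherent b α z)
  rw [h5, map_smul, raise_coherent, weyl_coherent]
  refine Eq.trans h4 ?_
  module

/-- The conjugation `D(α)⁻¹ a D(α) = a + α` in weak form: pairing with `a†` of coherent vectors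
reduces it to `weyl_coherentDeriv` for `-α`, and domain invariance follows at the same time. -/
theorem exists_lower_weyl (α : ℂ) (φ : ladderDomain b) :
    ∃ h : weyl b α (φ : H) ∈ ladderDomain b,
      lower b ⟨weyl b α (φ : H), h⟩ = weyl b α (lower b φ + α • (φ : H)) := by
  refine exists_lower_of_inner_coherentDeriv b fun z => ?_
  have e : ∀ x y : H, inner ℂ x (weyl b α y) = inner ℂ (weyl b (-α) x) y := fun x y => by
    rw [inner_weyl_left, neg_neg]
  rw [e, weyl_coherentDeriv, inner_sub_left, inner_raise_left, e, inner_add_right,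
    inner_smul_left, inner_smul_right]
  simp

theorem weyl_mem (α : ℂ) (φ : ladderDomain b) : weyl b α (φ : H) ∈ ladderDomain b :=
  (exists_lower_weyl b α φ).1

theorem lower_weyl (α : ℂ) (φ : ladderDomain b) :
    lower b ⟨weyl b α (φ : H), weyl_mem b α φ⟩ = weyl b α (lower b φ + α • (φ : H)) :=
  (exists_lower_weyl b α φ).2

/-! ## Differentiability in the displacement parameter -/

theorem ladderCombination_eq_re_add_im (X : ℂ) (φ : ladderDomain b) :
    ladderCombination b X φ =
      X.re • ladderCombination b 1 φ + X.im • ladderCombination b Complex.I φ := by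
  simp only [ladderCombination_apply, map_one, Complex.conj_I,
    RCLike.real_smul_eq_coe_smul (K := ℂ)]
  have h1 := Complex.re_add_im X
  have h2 : conj X = X.re - X.im * Complex.I := by
    apply Complex.ext <;> simp
  rw [h2]
  simp only [RCLike.ofReal_eq_complex_ofReal]
  match_scalars
  · linear_combination -h1
  · ring

/-- The real-linear map `X ↦ X a†φ - conj X · aφ`. -/
def ladderCLM (φ : ladderDomain b) : ℂ →L[ℝ] H :=
  Complex.reCLM.smulRight (ladderCombination b 1 φ) +
    Complex.imCLM.smulRight (ladderCombination b Complex.I φ)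

theorem ladderCLM_apply (φ : ladderDomain b) (X : ℂ) :
    ladderCLM b φ X = ladderCombination b X φ := by
  rw [ladderCombination_eq_re_add_im]
  rfl

/-- The mean value inequality along `s ↦ weyl b (s * h) φ`. The error is controlled by the two fixed
vectors `a†φ` and `aφ`, hence the `2` and the uniformity in the direction of `h`. -/
theorem norm_weyl_sub_sub_le (φ : ladderDomain b) {h : ℂ} {C : ℝ}
    (hr : ∀ s ∈ Set.Ico (0 : ℝ) 1, ‖weyl b (s * h) (raise b φ) - raise b φ‖ ≤ C)
    (hl : ∀ s ∈ Set.Ico (0 : ℝ) 1, ‖weyl b (s * h) (lower b φ) - lower b φ‖ ≤ C) :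
    ‖weyl b h (φ : H) - φ - ladderCombination b h φ‖ ≤ 2 * C * ‖h‖ := by
  have h1 : ∀ s ∈ Set.Icc (0 : ℝ) 1, HasDerivWithinAt
      (fun s : ℝ => weyl b (s * h) (φ : H) - s • ladderCombination b h φ)
      (weyl b (s * h) (ladderCombination b h φ) - ladderCombination b h φ) (Set.Icc 0 1) s := by
    intro s _
    have h2 := (hasDerivAt_weyl b h φ s).sub
      ((hasDerivAt_id s).smul_const (ladderCombination b h φ))
    rw [one_smul] at h2
    exact h2.hasDerivWithinAt
  have h3 := norm_image_sub_le_of_norm_deriv_le_segment_01' h1 (C := 2 * C * ‖h‖) fun s hs => by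
    have e : weyl b (s * h) (ladderCombination b h φ) - ladderCombination b h φ =
        h • (weyl b (s * h) (raise b φ) - raise b φ) -
          conj h • (weyl b (s * h) (lower b φ) - lower b φ) := by
      simp only [ladderCombination_apply, map_sub, map_smul]
      module
    rw [e]
    refine (norm_sub_le _ _).trans ?_
    rw [norm_smul, norm_smul, RCLike.norm_conj]
    have := mul_le_mul_of_nonneg_left (hr s hs) (norm_nonneg h)
    have := mul_le_mul_of_nonneg_left (hl s hs) (norm_nonneg h)
    linarith
  simpa [weyl_zero, sub_right_comm] using h3

theorem eventually_norm_weyl_sub_le (φ : H) {ε : ℝ} (hε : 0 < ε) :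
    ∀ᶠ h in 𝓝 (0 : ℂ), ∀ s ∈ Set.Ico (0 : ℝ) 1, ‖weyl b (s * h) φ - φ‖ ≤ ε := by
  have h1 : ∀ᶠ h in 𝓝 (0 : ℂ), ‖weyl b h φ - φ‖ < ε := by
    have h2 := ((continuous_weyl b φ).tendsto 0)
    rw [weyl_zero] at h2
    simpa [dist_eq_norm] using Metric.tendsto_nhds.1 h2 ε hε
  obtain ⟨δ, hδ, h3⟩ := Metric.eventually_nhds_iff.1 h1
  refine Metric.eventually_nhds_iff.2 ⟨δ, hδ, fun h hh s hs => (h3 ?_).le⟩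
  rw [dist_zero_right] at hh ⊢
  rw [norm_mul, Complex.norm_real, Real.norm_of_nonneg hs.1]
  exact (mul_le_of_le_one_left (norm_nonneg h) hs.2.le).trans_lt hh

theorem hasFDerivAt_weyl_zero (φ : ladderDomain b) :
    HasFDerivAt (fun α => weyl b α (φ : H)) (ladderCLM b φ) 0 := by
  rw [hasFDerivAt_iff_isLittleO_nhds_zero, Asymptotics.isLittleO_iff]
  intro c hc
  filter_upwards [eventually_norm_weyl_sub_le b (raise b φ) (half_pos hc),
    eventually_norm_weyl_sub_le b (lower b φ) (half_pos hc)] with h h1 h2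
  have h3 := norm_weyl_sub_sub_le b φ h1 h2
  rw [zero_add, weyl_zero, ladderCLM_apply]
  linarith

/-- The Weyl relation moves the base point to `0`: `weyl β` is a phase times `weyl α ∘ weyl (β -
α)`. The exponent of the phase is real-linear in `β - α` and produces the second term. -/
theorem exists_hasFDerivAt_weyl (φ : ladderDomain b) (α : ℂ) :
    ∃ L : ℂ →L[ℝ] H, HasFDerivAt (fun α => weyl b α (φ : H)) L α ∧
      ∀ X, L X = weyl b α (ladderCombination b X φ) +
        ((conj α * X - α * conj X) / 2) • weyl b α (φ : H) := by
  let q : ℂ →L[ℝ] ℂ := (2⁻¹ : ℂ) • (conj α • ContinuousLinearMap.id ℝ ℂ -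
    α • (Complex.conjCLE : ℂ →L[ℝ] ℂ))
  have hq : ∀ X, q X = (conj α * X - α * conj X) / 2 := by
    intro X
    simp [q]
    ring
  have h1 : HasFDerivAt (fun h => Complex.exp (q h)) q 0 := by
    have h := (q.hasFDerivAt (x := 0)).cexp
    rwa [map_zero, Complex.exp_zero, one_smul] at h
  have h2 : HasFDerivAt (fun h => weyl b α (weyl b h (φ : H)))
      ((((weyl b α).toContinuousLinearEquiv : H →L[ℂ] H).restrictScalars ℝ).comp
        (ladderCLM b φ)) 0 :=
    (((weyl b α).toContinuousLinearEquiv : H →L[ℂ] H).restrictScalars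
      ℝ).hasFDerivAt.comp 0 (hasFDerivAt_weyl_zero b φ)
  have h3 := h1.smul h2
  have h4 := HasFDerivAt.comp (f := fun β => β - α) α (by rwa [sub_self])
    ((hasFDerivAt_id α).sub_const α)
  refine ⟨_, h4.congr_of_eventuallyEq (Filter.Eventually.of_forall fun β => ?_), fun X => ?_⟩
  · change weyl b β (φ : H) =
      Complex.exp (q (β - α)) • weyl b α (weyl b (β - α) (φ : H))
    rw [weyl_weyl, smul_smul, ← Complex.exp_add, hq, add_sub_cancel]
    rw [← add_div, sub_add_sub_comm, add_comm (α * _) , sub_self, zero_div, Complex.exp_zero,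
      one_smul]
  · simp [weyl_zero, hq, ladderCLM_apply]

/-! ### Smoothness on rapidly decreasing vectors -/

/-- Vectors whose coordinates decay faster than every power. -/
def IsRapidlyDecreasing (φ : H) : Prop :=
  ∀ k : ℕ, Summable fun n : ℕ => ((n : ℝ) + 1) ^ k * ‖b.repr φ n‖ ^ 2

variable {b} in
theorem IsRapidlyDecreasing.mem_ladderDomain {φ : H} (h : IsRapidlyDecreasing b φ) :
    φ ∈ ladderDomain b := by
  refine Summable.of_nonneg_of_le (fun n => by positivity) (fun n => ?_) (h 1)
  rw [pow_one]
  gcongr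
  linarith

theorem isRapidlyDecreasing_lower {φ : ladderDomain b} (h : IsRapidlyDecreasing b (φ : H)) :
    IsRapidlyDecreasing b (lower b φ) := by
  intro k
  refine Summable.of_nonneg_of_le (fun n => by positivity) (fun n => ?_)
    ((summable_nat_add_iff 1).2 (h (k + 1)))
  have h0 : (0 : ℝ) ≤ (n : ℝ) + 1 := by positivity
  rw [repr_lower, norm_mul, mul_pow, Complex.norm_real, Real.norm_of_nonneg (Real.sqrt_nonneg _),
    Real.sq_sqrt h0, ← mul_assoc, ← pow_succ]
  gcongr
  linarith

theorem isRapidlyDecreasing_raise {φ : ladderDomain b} (h : IsRapidlyDecreasing b (φ : H)) :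
    IsRapidlyDecreasing b (raise b φ) := by
  intro k
  refine (summable_nat_add_iff 1).1 ?_
  refine Summable.of_nonneg_of_le (fun n => by positivity) (fun n => ?_)
    ((h (k + 1)).mul_left (2 ^ k))
  have h0 : (0 : ℝ) ≤ (n : ℝ) + 1 := by positivity
  rw [repr_raise_succ, norm_mul, mul_pow, Complex.norm_real,
    Real.norm_of_nonneg (Real.sqrt_nonneg _), Real.sq_sqrt h0, ← mul_assoc, ← mul_assoc]
  -- Raising shifts the index, so the weight is a power of `n + 2`, and `n + 2 ≤ 2 (n + 1)`.
  have h1 : (((n + 1 : ℕ) : ℝ) + 1) ^ k * ((n : ℝ) + 1) ≤ 2 ^ k * ((n : ℝ) + 1) ^ (k + 1) := by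
    rw [pow_succ ((n : ℝ) + 1), ← mul_assoc, ← mul_pow]
    gcongr
    push_cast
    linarith
  gcongr

/-- The derivative involves the orbits of `a†φ`, `aφ` and `φ`, all rapidly decreasing; the induction
is therefore on the order of smoothness with `φ` universally quantified. -/
theorem contDiff_nat_weyl (n : ℕ) : ∀ φ : H, IsRapidlyDecreasing b φ →
    ContDiff ℝ n fun α => weyl b α φ := by
  induction n with
  | zero => exact fun φ _ => contDiff_zero.2 (continuous_weyl b φ)
  | succ n ih =>
    intro φ hφ
    have hm := hφ.mem_ladderDomain
    choose L h1 h2 using exists_hasFDerivAt_weyl b ⟨φ, hm⟩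
    push_cast
    refine contDiff_succ_iff_fderiv_apply.2 ⟨fun α => (h1 α).differentiableAt, by simp, fun X => ?_⟩
    have h3 : (fun α => fderiv ℝ (fun α => weyl b α φ) α X) = fun α =>
        X • weyl b α (raise b ⟨φ, hm⟩) - conj X • weyl b α (lower b ⟨φ, hm⟩) +
          ((conj α * X - α * conj X) / 2) • weyl b α φ := by
      ext α
      rw [(h1 α).fderiv, h2, ladderCombination_apply, map_sub, map_smul, map_smul]
    rw [h3]
    have h4 := ih _ (isRapidlyDecreasing_raise b (φ := ⟨φ, hm⟩) hφ)
    have h5 := ih _ (isRapidlyDecreasing_lower b (φ := ⟨φ, hm⟩) hφ)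
    have h6 : ContDiff ℝ n fun α : ℂ => (conj α * X - α * conj X) / 2 :=
      ((Complex.conjCLE.contDiff.mul contDiff_const).sub
        (contDiff_id.mul contDiff_const)).div_const 2
    exact ((contDiff_const.smul h4).sub (contDiff_const.smul h5)).add (h6.smul (ih φ hφ))

theorem contDiff_weyl {φ : H} (hφ : IsRapidlyDecreasing b φ) :
    ContDiff ℝ ∞ fun α => weyl b α φ :=
  contDiff_infty.2 fun n => contDiff_nat_weyl b n φ hφ

/-! ## The squeezed vacuum -/

section SqueezedVacuum

/-- The coordinates of the unnormalised squeezed vacuum. -/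
def squeezedCoeff (v : ℝ) : ℕ → ℝ
  | 0 => 1
  | 1 => 0
  | n + 2 => -(Real.sinh v * √((n : ℝ) + 1) / (Real.cosh v * √((n : ℝ) + 2))) * squeezedCoeff v n

theorem abs_sinh_lt_cosh (v : ℝ) : |Real.sinh v| < Real.cosh v :=
  abs_lt_of_sq_lt_sq (by linarith [Real.cosh_sq v]) (Real.cosh_pos v).le

/-- Two steps of the index multiply the square by `tanh² v * (n + 1) / (n + 2) ≤ tanh² v`. -/
theorem squeezedCoeff_sq_le (v : ℝ) (n : ℕ) :
    squeezedCoeff v n ^ 2 ≤ (|Real.sinh v| / Real.cosh v) ^ n := by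
  have hc := Real.cosh_pos v
  induction n using Nat.twoStepInduction with
  | zero => simp [squeezedCoeff]
  | one =>
    rw [squeezedCoeff, zero_pow two_ne_zero]
    positivity
  | more n ih _ =>
    rw [squeezedCoeff, mul_pow, neg_sq, div_pow, mul_pow, mul_pow, Real.sq_sqrt (by positivity),
      Real.sq_sqrt (by positivity), pow_add, mul_comm (_ ^ n), div_pow, sq_abs]
    refine mul_le_mul ?_ ih (sq_nonneg _) (by positivity)
    rw [mul_div_mul_comm]
    refine mul_le_of_le_one_right (by positivity) ?_
    rw [div_le_one (by positivity)]
    linarith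

theorem summable_pow_mul_squeezedCoeff_sq (v : ℝ) (k : ℕ) :
    Summable fun n : ℕ => ((n : ℝ) + 1) ^ k * squeezedCoeff v n ^ 2 := by
  have hc := Real.cosh_pos v
  -- A ratio strictly above `|tanh v|` is positive even for `v = 0`, so it can be inverted to absorb
  -- the shift of the index.
  obtain ⟨ρ, h1, h2⟩ := exists_between ((div_lt_one hc).2 (abs_sinh_lt_cosh v))
  have h0 : 0 ≤ |Real.sinh v| / Real.cosh v := by positivity
  have hρ : 0 < ρ := h0.trans_lt h1
  have h3 := (summable_nat_add_iff 1).2 (summable_pow_mul_geometric_of_norm_lt_one (R := ℝ) k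
    (r := ρ) (by rwa [Real.norm_of_nonneg hρ.le]))
  refine Summable.of_nonneg_of_le (fun n => by positivity) (fun n => ?_) (h3.mul_left ρ⁻¹)
  have h4 : squeezedCoeff v n ^ 2 ≤ ρ ^ n :=
    (squeezedCoeff_sq_le v n).trans (pow_le_pow_left₀ h0 h1.le n)
  have h5 : ρ⁻¹ * ((((n + 1 : ℕ) : ℝ)) ^ k * ρ ^ (n + 1)) = ((n : ℝ) + 1) ^ k * ρ ^ n := by
    push_cast
    field_simp
    ring
  rw [h5]
  gcongr

/-- Coordinate `0` of the equation kills `⟨1|φ⟩`, and coordinate `n + 1` expresses `⟨n+2|φ⟩` through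
`⟨n|φ⟩`, because `cosh v ≠ 0`. -/
theorem squeezed_eq_zero_iff (v : ℝ) (φ : ladderDomain b) :
    ((Real.cosh v : ℝ) : ℂ) • lower b φ + ((Real.sinh v : ℝ) : ℂ) • raise b φ = 0 ↔
      ∀ n, b.repr (φ : H) n = b.repr (φ : H) 0 * squeezedCoeff v n := by
  have hc : ((Real.cosh v : ℝ) : ℂ) ≠ 0 := by exact_mod_cast (Real.cosh_pos v).ne'
  have e (x y : H) (c s : ℂ) (n : ℕ) :
      b.repr (c • x + s • y) n = c * b.repr x n + s * b.repr y n := by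
    rw [map_add, map_smul, map_smul]
    rfl
  have h0 : ((Real.cosh v : ℝ) : ℂ) • lower b φ + ((Real.sinh v : ℝ) : ℂ) • raise b φ = 0 ↔
      ∀ n, ((Real.cosh v : ℝ) : ℂ) * b.repr (lower b φ) n +
        ((Real.sinh v : ℝ) : ℂ) * b.repr (raise b φ) n = 0 := by
    constructor
    · intro h n
      rw [← e, h, map_zero]
      rfl
    · intro h
      refine ext_repr b fun n => ?_
      rw [e, h, map_zero]
      rfl
  have hs : ∀ n : ℕ, ((√((n : ℝ) + 2) : ℝ) : ℂ) ≠ 0 := fun n => by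
    have : (0 : ℝ) < √((n : ℝ) + 2) := by positivity
    exact_mod_cast this.ne'
  rw [h0]
  constructor
  · intro h n
    induction n using Nat.twoStepInduction with
    | zero => simp [squeezedCoeff]
    | one =>
      have h1 := h 0
      rw [repr_lower, repr_raise_zero] at h1
      simpa [squeezedCoeff] using (mul_eq_zero.1 (by simpa using h1)).resolve_left hc
    | more n ih _ =>
      have h1 := h (n + 1)
      rw [repr_lower, repr_raise_succ, ih] at h1
      have e : (((n + 1 : ℕ) : ℝ)) + 1 = n + 2 := by push_cast; ring
      rw [e] at h1
      have h2 := hs n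
      rw [squeezedCoeff]
      push_cast at h1 ⊢
      push_cast at hc
      field_simp
      linear_combination h1
  · intro h n
    rw [repr_lower]
    cases n with
    | zero =>
      rw [repr_raise_zero, h]
      simp [squeezedCoeff]
    | succ n =>
      have e : (((n + 1 : ℕ) : ℝ)) + 1 = n + 2 := by push_cast; ring
      have h2 := hs n
      rw [repr_raise_succ, h (n + 1 + 1), h n, squeezedCoeff, e]
      push_cast
      push_cast at hc
      field_simp
      ring

theorem isSqueezedVacuum_iff {v : ℝ} {ψ₀ : Metric.sphere (0 : H) 1} :
    IsSqueezedVacuum b v ψ₀ ↔ ∃ h : (ψ₀ : H) ∈ ladderDomain b,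
      ((Real.cosh v : ℝ) : ℂ) • lower b ⟨ψ₀, h⟩ + ((Real.sinh v : ℝ) : ℂ) • raise b ⟨ψ₀, h⟩ = 0 :=
  ⟨fun ⟨h, e⟩ => ⟨(mem_domain_squeezedAnnihilation b).1 h, e⟩,
    fun ⟨h, e⟩ => ⟨(mem_domain_squeezedAnnihilation b (v := v)).2 h, e⟩⟩

theorem exists_isSqueezedVacuum (v : ℝ) :
    ∃ ψ₀ : Metric.sphere (0 : H) 1, IsSqueezedVacuum b v ψ₀ := by
  have hm : Memℓp (fun n => (squeezedCoeff v n : ℂ)) 2 := by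
    refine (memℓp_gen_iff (p := 2) (by norm_num)).2 ?_
    simpa using summable_pow_mul_squeezedCoeff_sq v 0
  let x : H := b.repr.symm ⟨_, hm⟩
  have hx : ∀ n, b.repr x n = squeezedCoeff v n := fun n => by simp [x]
  have hx0 : x ≠ 0 := by
    intro h
    have h1 := hx 0
    simp [h, squeezedCoeff] at h1
  have hd : x ∈ ladderDomain b := by
    refine Summable.of_nonneg_of_le (fun n => by positivity) (fun n => ?_)
      (summable_pow_mul_squeezedCoeff_sq v 1)
    rw [hx, Complex.norm_real, Real.norm_eq_abs, sq_abs, pow_one]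
    gcongr
    linarith
  have h1 := (squeezed_eq_zero_iff b v ⟨x, hd⟩).2 fun n => by
    simp only [hx]
    simp [squeezedCoeff]
  refine ⟨⟨((‖x‖⁻¹ : ℝ) : ℂ) • x, ?_⟩, (isSqueezedVacuum_iff b).2
    ⟨Submodule.smul_mem _ _ hd, ?_⟩⟩
  · rw [mem_sphere_zero_iff_norm, norm_smul, Complex.norm_real, norm_inv, norm_norm,
      inv_mul_cancel₀ (norm_ne_zero_iff.2 hx0)]
  · have h2 : (⟨((‖x‖⁻¹ : ℝ) : ℂ) • x, Submodule.smul_mem _ _ hd⟩ : ladderDomain b) =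
        ((‖x‖⁻¹ : ℝ) : ℂ) • ⟨x, hd⟩ := rfl
    rw [h2, map_smul, map_smul, smul_comm, smul_comm _ (((‖x‖⁻¹ : ℝ) : ℂ)) (raise b _), ← smul_add,
      h1, smul_zero]

variable {b} {v : ℝ} {ψ₀ : Metric.sphere (0 : H) 1}

theorem IsSqueezedVacuum.repr_eq (h : IsSqueezedVacuum b v ψ₀) (n : ℕ) :
    b.repr (ψ₀ : H) n = b.repr (ψ₀ : H) 0 * squeezedCoeff v n := by
  obtain ⟨hd, h⟩ := (isSqueezedVacuum_iff b).1 h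
  exact (squeezed_eq_zero_iff b v ⟨ψ₀, hd⟩).1 h n

theorem IsSqueezedVacuum.isRapidlyDecreasing (h : IsSqueezedVacuum b v ψ₀) :
    IsRapidlyDecreasing b (ψ₀ : H) := by
  intro k
  refine ((summable_pow_mul_squeezedCoeff_sq v k).mul_left (‖b.repr (ψ₀ : H) 0‖ ^ 2)).congr
    fun n => ?_
  rw [h.repr_eq n, norm_mul, Complex.norm_real, mul_pow, Real.norm_eq_abs, sq_abs]
  ring

theorem ray_eq_of_smul_eq {ψ φ : Metric.sphere (0 : H) 1} {c : ℂ} (h : (ψ : H) = c • (φ : H)) :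
    ray ψ = ray φ := by
  have hc : ‖c‖ = 1 := by
    have h1 := congrArg norm h
    rw [norm_smul, mem_sphere_zero_iff_norm.1 ψ.2, mem_sphere_zero_iff_norm.1 φ.2, mul_one] at h1
    exact h1.symm
  refine Quotient.sound ⟨c.arg, ?_⟩
  have h2 := Complex.norm_mul_exp_arg_mul_I c
  rw [hc, Complex.ofReal_one, one_mul] at h2
  rw [h2, h]

theorem IsSqueezedVacuum.ray_eq {φ₀ : Metric.sphere (0 : H) 1} (h : IsSqueezedVacuum b v ψ₀)
    (h' : IsSqueezedVacuum b v φ₀) : ray ψ₀ = ray φ₀ := by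
  have h0 : b.repr (φ₀ : H) 0 ≠ 0 := by
    intro h0
    have h1 : (φ₀ : H) = 0 := ext_repr b fun n => by rw [h'.repr_eq n, h0]; simp
    have h2 := mem_sphere_zero_iff_norm.1 φ₀.2
    rw [h1, norm_zero] at h2
    exact zero_ne_one h2
  refine ray_eq_of_smul_eq (c := b.repr (ψ₀ : H) 0 / b.repr (φ₀ : H) 0) (ext_repr b fun n => ?_)
  rw [map_smul, lp.coeFn_smul, Pi.smul_apply, smul_eq_mul, h.repr_eq n, h'.repr_eq n]
  field_simp

/-- `η` is `a†ψ₀ / cosh v`. Its norm comes from `norm_raise_sq` and `cosh² - sinh² = 1`. Adjointness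
gives `cosh v ⟨η, ψ₀⟩ = -sinh v ⟨ψ₀, η⟩`, and comparing moduli with `|sinh v| < cosh v` forces
orthogonality. -/
theorem IsSqueezedVacuum.exists_excited (h : IsSqueezedVacuum b v ψ₀) :
    ∃ (hd : (ψ₀ : H) ∈ ladderDomain b) (η : H), ‖η‖ = 1 ∧ inner ℂ (ψ₀ : H) η = 0 ∧
      raise b ⟨ψ₀, hd⟩ = ((Real.cosh v : ℝ) : ℂ) • η ∧
      lower b ⟨ψ₀, hd⟩ = -((Real.sinh v : ℝ) : ℂ) • η := by
  obtain ⟨hd, h⟩ := (isSqueezedVacuum_iff b).1 h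
  have hc0 := Real.cosh_pos v
  have hc : ((Real.cosh v : ℝ) : ℂ) ≠ 0 := by exact_mod_cast hc0.ne'
  obtain ⟨η, hη⟩ : ∃ η, raise b ⟨ψ₀, hd⟩ = ((Real.cosh v : ℝ) : ℂ) • η :=
    ⟨((Real.cosh v : ℝ) : ℂ)⁻¹ • raise b ⟨ψ₀, hd⟩, by rw [smul_inv_smul₀ hc]⟩
  have hl : lower b ⟨ψ₀, hd⟩ = -((Real.sinh v : ℝ) : ℂ) • η := by
    rw [hη] at h
    refine smul_right_injective H hc ?_
    simp only
    rw [eq_neg_of_add_eq_zero_left h]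
    module
  refine ⟨hd, η, ?_, ?_, hη, hl⟩
  · have h1 := norm_raise_sq b ⟨ψ₀, hd⟩
    rw [hη, hl, norm_smul, norm_smul, norm_neg, Complex.norm_real, Complex.norm_real,
      mem_sphere_zero_iff_norm.1 ψ₀.2, mul_pow, mul_pow, Real.norm_eq_abs, Real.norm_eq_abs, sq_abs,
      sq_abs, Real.cosh_sq] at h1
    have h2 : ‖η‖ ^ 2 = 1 := by linarith
    exact (pow_eq_one_iff_of_nonneg (norm_nonneg _) two_ne_zero).1 h2
  · have h1 := inner_raise_left b ⟨ψ₀, hd⟩ ⟨ψ₀, hd⟩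
    rw [hη, hl, inner_smul_left, inner_smul_right, Complex.conj_ofReal] at h1
    have h2 := congrArg norm h1
    rw [norm_mul, norm_mul, norm_neg, norm_inner_symm, Complex.norm_real, Complex.norm_real,
      Real.norm_of_nonneg hc0.le, Real.norm_eq_abs] at h2
    have h3 := abs_sinh_lt_cosh v
    rw [← norm_eq_zero]
    by_contra h4
    exact h3.ne (mul_right_cancel₀ h4 h2).symm

/-! ## Tangent vectors and overlaps of squeezed states -/

/-- The complex coordinate, in the squeezed frame, of the displacement direction `X`. -/
def squeezedCoord (v : ℝ) (X : ℂ) : ℂ := Real.cosh v * X + Real.sinh v * conj X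

theorem squeezedCoord_eq (v : ℝ) (X : ℂ) :
    squeezedCoord v X = (X.re * Real.exp v : ℝ) + (X.im * Real.exp (-v) : ℝ) * Complex.I := by
  rw [squeezedCoord, ← Real.cosh_add_sinh, ← Real.cosh_sub_sinh]
  apply Complex.ext <;>
    simp [-Complex.ofReal_cosh, -Complex.ofReal_sinh, -Real.cosh_add_sinh,
      -Real.cosh_sub_sinh] <;>
    ring

theorem normSq_squeezedCoord (v : ℝ) (X : ℂ) :
    Complex.normSq (squeezedCoord v X) = (X.re * Real.exp v) ^ 2 + (X.im * Real.exp (-v)) ^ 2 := by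
  rw [squeezedCoord_eq, Complex.normSq_add_mul_I]

/-- `squeezedCoord v` stretches the axes by `eᵛ` and `e⁻ᵛ`, the smaller of which is `e^{-|v|}`. This
bound gives both the immersion and the embedding. -/
theorem exp_neg_abs_mul_norm_le (v : ℝ) (X : ℂ) :
    (Real.exp (-|v|) * ‖X‖) ^ 2 ≤ Complex.normSq (squeezedCoord v X) := by
  rw [normSq_squeezedCoord, mul_pow, ← Complex.normSq_eq_norm_sq, Complex.normSq_apply, mul_pow,
    mul_pow, mul_add]
  have h1 : Real.exp (-|v|) ^ 2 ≤ Real.exp v ^ 2 := by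
    gcongr
    exact neg_abs_le v
  have h2 : Real.exp (-|v|) ^ 2 ≤ Real.exp (-v) ^ 2 := by
    gcongr
    exact le_abs_self v
  nlinarith [mul_le_mul_of_nonneg_right h1 (sq_nonneg X.re),
    mul_le_mul_of_nonneg_right h2 (sq_nonneg X.im)]

/-- Moving `a` and `a†` across the Weyl operator gives two linear equations in `⟨ψ₀, W η⟩` and `⟨η,
W ψ₀⟩`; the second unknown is eliminated using `cosh² - sinh² = 1`. -/
theorem inner_weyl_excited {η : H} (hd : (ψ₀ : H) ∈ ladderDomain b)
    (hr : raise b ⟨ψ₀, hd⟩ = ((Real.cosh v : ℝ) : ℂ) • η)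
    (hl : lower b ⟨ψ₀, hd⟩ = -((Real.sinh v : ℝ) : ℂ) • η) (γ : ℂ) :
    inner ℂ (ψ₀ : H) (weyl b γ η) =
      -conj (squeezedCoord v γ) * inner ℂ (ψ₀ : H) (weyl b γ (ψ₀ : H)) := by
  have e : ∀ x y : H, inner ℂ x (weyl b γ y) = inner ℂ (weyl b (-γ) x) y := fun x y => by
    rw [inner_weyl_left, neg_neg]
  have h1 := inner_lower_left b ⟨_, weyl_mem b (-γ) ⟨ψ₀, hd⟩⟩ ⟨ψ₀, hd⟩
  rw [lower_weyl, hl, hr, inner_smul_right] at h1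
  simp only [← e, inner_add_left, inner_smul_left] at h1
  have h2 := inner_raise_left b ⟨ψ₀, hd⟩ ⟨_, weyl_mem b γ ⟨ψ₀, hd⟩⟩
  rw [lower_weyl, hl, hr, inner_smul_left] at h2
  simp only [map_add, map_smul, inner_add_right, inner_smul_right] at h2
  simp only [map_neg, Complex.conj_ofReal] at h1 h2
  have h3 : ((Real.cosh v : ℝ) : ℂ) ^ 2 - ((Real.sinh v : ℝ) : ℂ) ^ 2 = 1 := by
    exact_mod_cast Real.cosh_sq_sub_sinh_sq v
  simp only [squeezedCoord, map_add, map_mul, Complex.conj_ofReal, Complex.conj_conj]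
  linear_combination -inner ℂ (ψ₀ : H) (weyl b γ η) * h3 - ((Real.cosh v : ℝ) : ℂ) * h1 -
    ((Real.sinh v : ℝ) : ℂ) * h2

theorem ladderCombination_excited {η : H} (hd : (ψ₀ : H) ∈ ladderDomain b)
    (hr : raise b ⟨ψ₀, hd⟩ = ((Real.cosh v : ℝ) : ℂ) • η)
    (hl : lower b ⟨ψ₀, hd⟩ = -((Real.sinh v : ℝ) : ℂ) • η) (X : ℂ) :
    ladderCombination b X ⟨ψ₀, hd⟩ = squeezedCoord v X • η := by
  rw [ladderCombination_apply, hr, hl, squeezedCoord]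
  module

/-- Along `t ↦ t * β` the overlap satisfies `f' = -t m f`, so `f * exp (t² m / 2)` is constant. -/
theorem IsSqueezedVacuum.inner_weyl (h : IsSqueezedVacuum b v ψ₀) (β : ℂ) :
    inner ℂ (ψ₀ : H) (weyl b β (ψ₀ : H)) =
      Complex.exp (-(Complex.normSq (squeezedCoord v β) : ℂ) / 2) := by
  obtain ⟨hd, η, -, -, hr, hl⟩ := h.exists_excited
  set m : ℂ := (Complex.normSq (squeezedCoord v β) : ℂ) with hm
  have h1 : ∀ t : ℝ, HasDerivAt (fun t : ℝ => inner ℂ (ψ₀ : H) (weyl b (t * β) (ψ₀ : H)))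
      (-(t * m) * inner ℂ (ψ₀ : H) (weyl b (t * β) (ψ₀ : H))) t := by
    intro t
    have h2 := (hasDerivAt_const t (ψ₀ : H)).inner ℂ (hasDerivAt_weyl b β ⟨ψ₀, hd⟩ t)
    refine h2.congr_deriv ?_
    have h3 : squeezedCoord v (t * β) = t * squeezedCoord v β := by
      simp only [squeezedCoord, map_mul, Complex.conj_ofReal]
      ring
    rw [ladderCombination_excited hd hr hl, map_smul, inner_smul_right, inner_zero_left, add_zero,
      inner_weyl_excited hd hr hl, h3, hm, ← Complex.mul_conj, map_mul, Complex.conj_ofReal]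
    ring
  have h2 : ∀ t : ℝ, HasDerivAt (fun t : ℝ => Complex.exp ((t : ℂ) ^ 2 * m / 2))
      (Complex.exp ((t : ℂ) ^ 2 * m / 2) * (t * m)) t := by
    intro t
    have h3 := ((((hasDerivAt_id (t : ℂ)).pow 2).mul_const m).div_const 2).cexp.comp_ofReal
    refine HasDerivAt.congr_deriv h3 ?_
    simp
    ring
  have h3 := is_const_of_deriv_eq_zero (fun t => ((h1 t).mul (h2 t)).differentiableAt)
    (fun t => by rw [((h1 t).mul (h2 t)).deriv]; ring) 1 0
  simp only [Pi.mul_apply, Complex.ofReal_one, one_mul, one_pow, Complex.ofReal_zero, zero_mul,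
    weyl_zero, ne_eq, OfNat.ofNat_ne_zero, not_false_eq_true, zero_pow, zero_div,
    Complex.exp_zero, mul_one] at h3
  rw [inner_self_eq_norm_sq_to_K, mem_sphere_zero_iff_norm.1 ψ₀.2] at h3
  rw [neg_div, Complex.exp_neg]
  refine eq_inv_of_mul_eq_one_left ?_
  simpa using h3

theorem IsSqueezedVacuum.norm_inner_weyl_weyl (h : IsSqueezedVacuum b v ψ₀) (z w : ℂ) :
    ‖inner ℂ (weyl b z (ψ₀ : H)) (weyl b w (ψ₀ : H))‖ =
      Real.exp (-Complex.normSq (squeezedCoord v (w - z)) / 2) := by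
  rw [inner_weyl_left, weyl_weyl, inner_smul_right, neg_add_eq_sub, h.inner_weyl, norm_mul,
    Complex.norm_exp, Complex.norm_exp, ← Real.exp_add]
  congr 1
  have h1 : (-(Complex.normSq (squeezedCoord v (w - z)) : ℂ) / 2) =
      ((-Complex.normSq (squeezedCoord v (w - z)) / 2 : ℝ) : ℂ) := by push_cast; rfl
  rw [h1, Complex.ofReal_re]
  simp

end SqueezedVacuum

/-! ## Geometry of the ray space -/

section RayGeometry

variable {ψ : H} {c : ℂ}

theorem inner_self_eq_one (h : ‖ψ‖ = 1) : inner ℂ ψ ψ = 1 := by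
  rw [inner_self_eq_norm_sq_to_K, h]
  simp

theorem conj_mul_self_eq_one (h : ‖c‖ = 1) : conj c * c = 1 := by
  rw [mul_comm, Complex.mul_conj, Complex.normSq_eq_norm_sq, h]
  simp

theorem inner_proj_right (h : ‖ψ‖ = 1) (x : H) : inner ℂ ψ (proj ψ x) = 0 := by
  rw [proj, inner_sub_right, inner_smul_right, inner_self_eq_one h, mul_one, sub_self]

theorem fubiniStudy_eq_inner_proj (h : ‖ψ‖ = 1) (x y : H) :
    fubiniStudy ψ x y = inner ℂ (proj ψ x) (proj ψ y) := by
  rw [fubiniStudy, proj.eq_1 ψ x, inner_sub_left, inner_smul_left, inner_proj_right h, mul_zero,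
    sub_zero]

/-- Gauge covariance: changing a lift by a phase adds a multiple of `ψ` to its derivative, which the
projector removes, and rotates the rest. -/
theorem proj_smul_add_smul (h : ‖ψ‖ = 1) (hc : ‖c‖ = 1) (d : ℂ) (x : H) :
    proj (c • ψ) (d • ψ + c • x) = c • proj ψ x := by
  have h1 := conj_mul_self_eq_one hc
  simp only [proj, inner_smul_left, inner_add_right, inner_smul_right, inner_self_eq_one h]
  match_scalars
  · linear_combination -(d + c * inner ℂ ψ x) * h1
  · ring

theorem ray_eq_iff {ψ φ : Metric.sphere (0 : H) 1} :
    ray ψ = ray φ ↔ ∃ γ : ℝ, (ψ : H) = Complex.exp (γ * Complex.I) • (φ : H) :=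
  Quotient.eq

/-- Two lifts of a map to the ray space have projected derivatives that agree up to a phase. -/
theorem exists_proj_fderiv_eq {F : ℂ → Metric.sphere (0 : H) 1} {z : ℂ} {L : ℂ →L[ℝ] H}
    (hF : HasFDerivAt (fun w => (F w : H)) L z) {ψ : ℂ → H}
    (hψ : IsLiftNear (fun w => ray (F w)) z ψ) (hd : DifferentiableAt ℝ ψ z) :
    ∃ c : ℂ, ‖c‖ = 1 ∧ ‖ψ z‖ = 1 ∧
      ∀ X, proj (ψ z) (fderiv ℝ ψ z X) = c • proj (F z : H) (L X) := by
  have hn : ∀ w, ‖(F w : H)‖ = 1 := fun w => mem_sphere_zero_iff_norm.1 (F w).2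
  -- The pointwise phases need not be chosen coherently: the relative phase is recovered as an inner
  -- product, hence is differentiable.
  have h1 : ∀ᶠ w in 𝓝 z, ψ w = inner ℂ (F w : H) (ψ w) • (F w : H) := by
    filter_upwards [hψ] with w ⟨h, e⟩
    obtain ⟨γ, hγ⟩ := ray_eq_iff.1 e
    simp only at hγ
    rw [hγ, inner_smul_right, inner_self_eq_one (hn w), mul_one]
  have h2 : HasFDerivAt (fun w => inner ℂ (F w : H) (ψ w))
      (fderiv ℝ (fun w => inner ℂ (F w : H) (ψ w)) z) z :=
    (hF.differentiableAt.inner ℂ hd).hasFDerivAt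
  have h3 := ((h2.smul hF).congr_of_eventuallyEq h1).fderiv
  obtain ⟨hz, -⟩ := hψ.self_of_nhds
  have hz := mem_sphere_zero_iff_norm.1 hz
  have e := h1.self_of_nhds
  have hc : ‖inner ℂ (F z : H) (ψ z)‖ = 1 := by
    have h4 := congrArg norm e
    rwa [norm_smul, hn, mul_one, hz, eq_comm] at h4
  refine ⟨_, hc, hz, fun X => ?_⟩
  rw [h3, ← proj_smul_add_smul (hn z) hc
    (fderiv ℝ (fun w => inner ℂ (F w : H) (ψ w)) z X), ← e]
  congr 1
  exact add_comm (inner ℂ (F z : H) (ψ z) • L X) _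

/-- The modulus of the overlap with `x`, as a function on the ray space. -/
def overlap (x : H) : RaySpace H → ℝ :=
  Quotient.lift (fun ψ : Metric.sphere (0 : H) 1 => ‖inner ℂ x (ψ : H)‖) (by
    rintro ψ φ ⟨γ, h⟩
    rw [h, inner_smul_right, norm_mul, Complex.norm_exp_ofReal_mul_I, one_mul])

theorem overlap_ray (x : H) (ψ : Metric.sphere (0 : H) 1) :
    overlap x (ray ψ) = ‖inner ℂ x (ψ : H)‖ := rfl

theorem continuous_overlap (x : H) : Continuous (overlap x) :=
  Continuous.quotient_lift (by fun_prop) _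

theorem continuous_ray : Continuous (ray : Metric.sphere (0 : H) 1 → RaySpace H) :=
  continuous_quotient_mk'

end RayGeometry

/-! ## The squeezed states in the ray space -/

variable {b} {v : ℝ} {ψ₀ : Metric.sphere (0 : H) 1}

theorem coe_squeezedState (α : ℂ) : (squeezedState b ψ₀ α : H) = weyl b α (ψ₀ : H) := by
  exact DFunLike.congr_fun (displacement_eq_weyl b α) (ψ₀ : H)

namespace IsSqueezedVacuum

theorem contDiff (h : IsSqueezedVacuum b v ψ₀) :
    ContDiff ℝ ∞ fun α : ℂ => (squeezedState b ψ₀ α : H) := by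
  simp only [coe_squeezedState]
  exact contDiff_weyl b h.isRapidlyDecreasing

theorem isLiftNear (b : HilbertBasis ℕ ℂ H) (ψ₀ : Metric.sphere (0 : H) 1) (z : ℂ) :
    IsLiftNear (fun α => ray (squeezedState b ψ₀ α)) z fun α => (squeezedState b ψ₀ α : H) :=
  Filter.Eventually.of_forall fun w => ⟨(squeezedState b ψ₀ w).2, rfl⟩

theorem differentiableAt (h : IsSqueezedVacuum b v ψ₀) (z : ℂ) :
    DifferentiableAt ℝ (fun α : ℂ => (squeezedState b ψ₀ α : H)) z :=
  h.contDiff.differentiable (by simp) z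

/-- The part of the derivative along the state is projected away, leaving `squeezedCoord v X` times
the displaced `η`, up to a phase depending on the lift. Immersion, pull-back and complex linearity
are all read off from this. -/
theorem exists_proj_fderiv_eq (h : IsSqueezedVacuum b v ψ₀) {z : ℂ} {ψ : ℂ → H}
    (hψ : IsLiftNear (fun α => ray (squeezedState b ψ₀ α)) z ψ) (hd : DifferentiableAt ℝ ψ z) :
    ‖ψ z‖ = 1 ∧ ∃ ξ : H, ‖ξ‖ = 1 ∧
      ∀ X, proj (ψ z) (fderiv ℝ ψ z X) = squeezedCoord v X • ξ := by
  obtain ⟨hm, η, hη, ho, hr, hl⟩ := h.exists_excited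
  obtain ⟨L, hL, e⟩ := exists_hasFDerivAt_weyl b ⟨ψ₀, hm⟩ z
  have hF : HasFDerivAt (fun w => (squeezedState b ψ₀ w : H)) L z := by
    simpa only [coe_squeezedState] using hL
  obtain ⟨c, hc, hz, hp⟩ := Squeezed.exists_proj_fderiv_eq hF hψ hd
  refine ⟨hz, c • weyl b z η, by rw [norm_smul, LinearIsometryEquiv.norm_map, hc, hη, one_mul],
    fun X => ?_⟩
  rw [hp, e, ladderCombination_excited hm hr hl, coe_squeezedState, smul_comm]
  congr 1
  rw [proj, inner_add_right, inner_smul_right, LinearIsometryEquiv.inner_map_map,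
    LinearIsometryEquiv.inner_map_map, inner_smul_right, ho,
    inner_self_eq_one (mem_sphere_zero_iff_norm.1 ψ₀.2), map_smul]
  module

theorem pullback_eq (h : IsSqueezedVacuum b v ψ₀) {z : ℂ} {ψ : ℂ → H}
    (hψ : IsLiftNear (fun α => ray (squeezedState b ψ₀ α)) z ψ) (hd : DifferentiableAt ℝ ψ z)
    (X Y : ℂ) :
    pullback ψ z X Y = ((Y.re * X.re * Real.exp (2 * v) + Y.im * X.im * Real.exp (-2 * v) : ℝ) : ℂ)
      + Complex.I * ((X.re * Y.im - X.im * Y.re : ℝ) : ℂ) := by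
  obtain ⟨hz, ξ, hξ, e⟩ := h.exists_proj_fderiv_eq hψ hd
  have h1 : Real.exp (2 * v) = Real.exp v * Real.exp v := by rw [← Real.exp_add, two_mul]
  have h2 : Real.exp (-2 * v) = Real.exp (-v) * Real.exp (-v) := by
    rw [← Real.exp_add]
    ring_nf
  -- The stretching factors are reciprocal, so the area form does not see `v`.
  have h3 : Real.exp v * Real.exp (-v) = 1 := by rw [← Real.exp_add, add_neg_cancel, Real.exp_zero]
  rw [pullback, fubiniStudy_eq_inner_proj hz, e, e, inner_smul_left, inner_smul_right,
    inner_self_eq_one hξ, squeezedCoord_eq, squeezedCoord_eq, h1, h2]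
  apply Complex.ext
  · simp [-Complex.ofReal_exp]
    ring
  · simp [-Complex.ofReal_exp]
    linear_combination (X.re * Y.im - X.im * Y.re) * h3

theorem hasPullbackAt (h : IsSqueezedVacuum b v ψ₀) (z : ℂ) :
    HasPullbackAt (fun α => ray (squeezedState b ψ₀ α)) z fun X Y =>
      ((Y.re * X.re * Real.exp (2 * v) + Y.im * X.im * Real.exp (-2 * v) : ℝ) : ℂ)
        + Complex.I * ((X.re * Y.im - X.im * Y.re : ℝ) : ℂ) :=
  fun _ hψ hd X Y => h.pullback_eq hψ hd X Y

theorem overlap_squeezedState (h : IsSqueezedVacuum b v ψ₀) (z w : ℂ) :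
    overlap (squeezedState b ψ₀ z : H) (ray (squeezedState b ψ₀ w)) =
      Real.exp (-Complex.normSq (squeezedCoord v (w - z)) / 2) := by
  rw [overlap_ray, coe_squeezedState, coe_squeezedState, h.norm_inner_weyl_weyl]

theorem isEmbedding (h : IsSqueezedVacuum b v ψ₀) :
    Topology.IsEmbedding fun α => ray (squeezedState b ψ₀ α) := by
  have hc : Continuous fun α => ray (squeezedState b ψ₀ α) :=
    continuous_ray.comp (h.contDiff.continuous.subtype_mk _)
  -- The logarithm of the Gaussian overlap recovers the squared distance, up to a constant;
  -- injectivity and the continuity of the inverse both follow.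
  have h0 : ∀ z w, Real.exp (-|v|) ^ 2 * ‖w - z‖ ^ 2 ≤
      -2 * Real.log (overlap (squeezedState b ψ₀ z : H) (ray (squeezedState b ψ₀ w))) := by
    intro z w
    rw [h.overlap_squeezedState, Real.log_exp, ← mul_pow]
    linarith [exp_neg_abs_mul_norm_le v (w - z)]
  have hself : ∀ z, overlap (squeezedState b ψ₀ z : H) (ray (squeezedState b ψ₀ z)) = 1 := by
    intro z
    rw [h.overlap_squeezedState]
    simp [squeezedCoord]
  refine ⟨⟨?_⟩, fun z w e => ?_⟩
  · refine (Topology.isInducing_iff_nhds.2 fun z =>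
      le_antisymm hc.continuousAt.le_comap ?_).eq_induced
    -- The function extends to all rays, and at the base ray the overlap is `1`, away from the
    -- singularity of the logarithm.
    have h1 : Filter.Tendsto (fun r => -2 * Real.log (overlap (squeezedState b ψ₀ z : H) r))
        (𝓝 (ray (squeezedState b ψ₀ z))) (𝓝 0) := by
      have h2 := (Real.continuousAt_log one_ne_zero).tendsto
      rw [← hself z, hself z, Real.log_one] at h2
      have h3 := (continuous_overlap (squeezedState b ψ₀ z : H)).tendsto
        (ray (squeezedState b ψ₀ z))
      rw [hself] at h3
      simpa using (h2.comp h3).const_mul (-2)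
    intro s hs
    obtain ⟨ε, hε, hs⟩ := Metric.mem_nhds_iff.1 hs
    refine Filter.mem_comap.2 ⟨_, h1.eventually (gt_mem_nhds
      (show 0 < Real.exp (-|v|) ^ 2 * ε ^ 2 by positivity)), fun w hw => hs ?_⟩
    have h4 := (h0 z w).trans_lt hw
    rw [mul_lt_mul_iff_right₀ (by positivity)] at h4
    rw [mem_ball_iff_norm]
    exact lt_of_pow_lt_pow_left₀ 2 hε.le h4
  · have h1 := h0 z w
    rw [← show ray (squeezedState b ψ₀ z) = ray (squeezedState b ψ₀ w) from e, hself,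
      Real.log_one, mul_zero, ← mul_pow] at h1
    have h2 : Real.exp (-|v|) * ‖w - z‖ = 0 :=
      pow_eq_zero_iff two_ne_zero |>.1 (le_antisymm h1 (sq_nonneg _))
    have h3 := (mul_eq_zero.1 h2).resolve_left (Real.exp_ne_zero _)
    exact (sub_eq_zero.1 (norm_eq_zero.1 h3)).symm

theorem isSmoothEmbedding (h : IsSqueezedVacuum b v ψ₀) :
    IsSmoothEmbedding fun α => ray (squeezedState b ψ₀ α) where
  smooth z := ⟨_, isLiftNear b ψ₀ z, h.contDiff.contDiffAt⟩
  immersion z ψ hψ hd X hX := by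
    obtain ⟨-, ξ, hξ, e⟩ := h.exists_proj_fderiv_eq hψ hd
    have hξ0 : ξ ≠ 0 := by
      rintro rfl
      simp at hξ
    rw [e, smul_eq_zero, or_iff_left hξ0] at hX
    have h1 := exp_neg_abs_mul_norm_le v X
    rw [hX, map_zero] at h1
    have h2 : Real.exp (-|v|) * ‖X‖ = 0 :=
      pow_eq_zero_iff two_ne_zero |>.1 (le_antisymm h1 (sq_nonneg _))
    exact norm_eq_zero.1 ((mul_eq_zero.1 h2).resolve_left (Real.exp_ne_zero _))
  isEmbedding := h.isEmbedding

theorem isSymplecticEmbedding (h : IsSqueezedVacuum b v ψ₀) :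
    IsSymplecticEmbedding fun α => ray (squeezedState b ψ₀ α) where
  toIsSmoothEmbedding := h.isSmoothEmbedding
  symplectic z ψ hψ hd X Y := by
    rw [h.pullback_eq hψ hd]
    simp [-Complex.ofReal_exp]
    ring

theorem pullsBackMetricAt_iff (h : IsSqueezedVacuum b v ψ₀) (z : ℂ) :
    PullsBackMetricAt (fun α => ray (squeezedState b ψ₀ α)) z ↔ v = 0 := by
  constructor
  · intro hm
    -- On `X = Y = 1` the pulled-back metric is `exp (2 * v)` and the standard one is `1`.
    have h1 := hm _ (isLiftNear b ψ₀ z) (h.differentiableAt z) 1 1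
    rw [h.pullback_eq (isLiftNear b ψ₀ z) (h.differentiableAt z)] at h1
    have h2 : Real.exp (2 * v) = 1 := by simpa [-Complex.ofReal_exp] using h1
    simpa using h2
  · rintro rfl ψ hψ hd X Y
    rw [h.pullback_eq hψ hd]
    simp [-Complex.ofReal_exp]
    ring

/-- The metric at a single point already forces `v = 0`; conversely `squeezedCoord 0` is the
identity, so the differential is complex linear. -/
theorem isKahlerEmbedding_iff (h : IsSqueezedVacuum b v ψ₀) :
    IsKahlerEmbedding (fun α => ray (squeezedState b ψ₀ α)) ↔ v = 0 := by
  refine ⟨fun hk => (h.pullsBackMetricAt_iff 0).1 (hk.metric 0), fun hv =>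
    ⟨h.isSymplecticEmbedding, fun z => (h.pullsBackMetricAt_iff z).2 hv, ?_⟩⟩
  intro z ψ hψ hd X
  obtain ⟨-, ξ, -, e⟩ := h.exists_proj_fderiv_eq hψ hd
  rw [e, e, smul_smul]
  simp [squeezedCoord, hv]

end IsSqueezedVacuum

end Squeezed

end

theorem mainTheorem2 {H : Type*} [NormedAddCommGroup H] [InnerProductSpace ℂ H]
    (b : HilbertBasis ℕ ℂ H) :
    -- `D(α) = exp (α a† - conj α · a)` is well defined
    (∀ α : ℂ, ∃! U : ℝ → (H ≃ₗᵢ[ℂ] H),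
      Squeezed.IsUnitaryGroupGeneratedBy (Squeezed.displacementGenerator b α) U) ∧
    ∀ v : ℝ,
      -- the squeezed vacuum exists and is unique up to a phase
      (∃ ψ₀ : Metric.sphere (0 : H) 1, Squeezed.IsSqueezedVacuum b v ψ₀) ∧
      (∀ ψ₀ φ₀ : Metric.sphere (0 : H) 1, Squeezed.IsSqueezedVacuum b v ψ₀ →
        Squeezed.IsSqueezedVacuum b v φ₀ → Squeezed.ray ψ₀ = Squeezed.ray φ₀) ∧
      ∀ ψ₀ : Metric.sphere (0 : H) 1, Squeezed.IsSqueezedVacuum b v ψ₀ →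
        -- the squeezed states depend smoothly on `α`
        ContDiff ℝ ∞ (fun α : ℂ => (Squeezed.squeezedState b ψ₀ α : H)) ∧
        -- the pulled-back Fubini-Study form
        (∀ z : ℂ, Squeezed.HasPullbackAt (fun α => Squeezed.ray (Squeezed.squeezedState b ψ₀ α)) z
          (fun X Y =>
            ((Y.re * X.re * Real.exp (2 * v) + Y.im * X.im * Real.exp (-2 * v) : ℝ) : ℂ)
              + Complex.I * ((X.re * Y.im - X.im * Y.re : ℝ) : ℂ))) ∧
        -- the symplectic part is standard for every `v`, the metric only for `v = 0`
        Squeezed.IsSymplecticEmbedding (fun α => Squeezed.ray (Squeezed.squeezedState b ψ₀ α)) ∧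
        (∀ z : ℂ, Squeezed.PullsBackMetricAt
          (fun α => Squeezed.ray (Squeezed.squeezedState b ψ₀ α)) z ↔ v = 0) ∧
        (Squeezed.IsKahlerEmbedding (fun α => Squeezed.ray (Squeezed.squeezedState b ψ₀ α)) ↔
          v = 0) := by
  refine ⟨Squeezed.existsUnique_isUnitaryGroupGeneratedBy b, fun v =>
    ⟨Squeezed.exists_isSqueezedVacuum b v, fun _ _ h h' => h.ray_eq h', fun _ h =>
      ⟨h.contDiff, h.hasPullbackAt, h.isSymplecticEmbedding, h.pullsBackMetricAt_iff,
        h.isKahlerEmbedding_iff⟩⟩⟩
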